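/- **Theorem 4.** Let $\xi_1,\xi_2,\dots$ be i.i.d. uniform $(0,1)$ random variables with order statistics $\xi_{n1}\le\dots\le\xi_{nn}$. *Kernel (Assumption 1).* Let $k\ge 0$ be a bounded probability density on $\mathbb R$ with mean zero and finite variance whose distribution function $K(x)=\int_{-\infty}^x k$ is differentiable. *Bandwidth (Assumption 2).* Let $b=b_n>0$ with $b_n\to0$ and $nb_n\to\infty$. Put $$F_{n,b}(t)=\frac1{nb}\sum_{i=1}^n\int_{-\infty}^t k\Big(\frac{x-\xi_i}{b}\Big)dx,\qquad F_{n,b}^{-1}(u)=\inf\{t: F_{n,b}(t)\ge u\}.$$ Let $g:(0,1)\to\mathbb R$ be left continuous and of bounded variation on $(\theta,1-\theta)$ for every $\theta\in(0,1/2)$, and let $|g|$ as a measure (as in $d|g|$) denote its total variation measure on $(0,1)$. Let $J:(0,1)\to\mathbb R$ be measurable, let $c_{n1},\dots,c_{nn}$ $(n\ge1)$ be real constants, and let $J_n(t)=c_{ni}$ for $(i-1)/n<t\le i/n$. Fix $M,b_1,b_2,\delta>0$ and put, for $0<t<1$, $$B(t)=Mt^{-b_1}(1-t)^{-b_2},\quad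 D(t)=Mt^{-1+b_1+\delta}(1-t)^{-1+b_2+\delta},\quad h(t)=[t(1-t)]^{1-\delta/2}.$$ *Boundedness (Assumption 3).* $|g|\le D$, $|J_n|\le B$ (for all $n\ge1$) and $|J|\le B$ pointwise on $(0,1)$, and $\int_0^1 Bh\,d|g|<\infty$. *Smoothness (Assumption 4).* For $|g|$-almost every $t$, $J$ is continuous at $t$ and $J_n\to J$ uniformly in some neighbourhood of $t$; moreover $J_n(t)\to J(t)$ for Lebesgue-almost every $t\in(0,1)$ with $g(t)\neq0$ (this is automatic if Lebesgue measure on $(0,1)$ is absolutely continuous with respect to the measure $|g|$). Then $Jg$ is Lebesgue integrable on $(0,1)$, so that $\mu=\int_0^1 J(t)g(t)\,dt$ is finite, and with probability one $$T_n=\int_0^1 g\big(F_{n,b}^{-1}(u)\big)J_n(u)\,du\ \longrightarrow\ \mu\qquad(n\to\infty),$$ where the integrand is read as $0$ at those $u$ for which $F_{n,b}^{-1}(u)\notin(0,1)$, and the integral defining $T_n$ converges absolutely for every $n\ge1$. Likewise, with probability one, the associated linear function of order statistics satisfies $$\frac1n\sum_{i=1}^n g(\xi_{ni})\,c_{ni}\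 \longrightarrow\ \mu .$$ -/

import Mathlib

open MeasureTheory ProbabilityTheory Filter Set
open scoped Topology ENNReal

noncomputable section

namespace KernelLStat

/-! ### Kernel estimator of the distribution function -/

/-- The distribution function `K(x) = ∫_{-∞}^x k` of a kernel density `k`. -/
def kernelCDF (k : ℝ → ℝ) (x : ℝ) : ℝ := ∫ t in Iic x, k t

/-- `k` is a bounded probability density on `ℝ` with mean zero and finite variance, whose
distribution function is differentiable. (Integrability of `x ↦ x * k x` follows from that of `k`
and of `x ↦ x ^ 2 * k x`.) -/
structure IsKernelDensity (k : ℝ → ℝ) : Prop where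
  nonneg : ∀ x, 0 ≤ k x
  bounded : ∃ C : ℝ, ∀ x, k x ≤ C
  integrable : Integrable k
  integral_eq_one : ∫ x, k x = 1
  integrable_sq : Integrable fun x => x ^ 2 * k x
  mean_zero : ∫ x, x * k x = 0
  differentiable_cdf : Differentiable ℝ (kernelCDF k)

/-- The bandwidths `b n > 0` satisfy `b n → 0` and `n * b n → ∞`. -/
structure IsBandwidth (b : ℕ → ℝ) : Prop where
  pos : ∀ n, 1 ≤ n → 0 < b n
  tendsto_zero : Tendsto b atTop (𝓝 0)
  tendsto_mul_atTop : Tendsto (fun n : ℕ => (n : ℝ) * b n) atTop atTop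

/-- The kernel distribution function estimator
`F_{n,b}(t) = (1 / (n b)) ∑_{i=1}^n ∫_{-∞}^t k ((y - x i) / b) dy` of the sample `x`. -/
def kernelEstimator (k : ℝ → ℝ) {n : ℕ} (b : ℝ) (x : Fin n → ℝ) (t : ℝ) : ℝ :=
  1 / (n * b) * ∑ i, ∫ y in Iic t, k ((y - x i) / b)

/-- The left-continuous inverse `F⁻¹(u) = inf {t | u ≤ F t}`. -/
def leftInverse (F : ℝ → ℝ) (u : ℝ) : ℝ := sInf {t | u ≤ F t}

/-! ### Functions on `(0, 1)` that are left continuous and locally of bounded variation -/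

/-- `g` is left continuous on `(0, 1)` and of bounded variation on `(θ, 1 - θ)` for every
`θ ∈ (0, 1/2)`. Only the values of `g` on `(0, 1)` matter. -/
structure IsClassG (g : ℝ → ℝ) : Prop where
  leftCont : ∀ t ∈ Ioo (0 : ℝ) 1, ContinuousWithinAt g (Iic t) t
  bddVar : ∀ θ ∈ Ioo (0 : ℝ) (1 / 2), BoundedVariationOn g (Ioo θ (1 - θ))

theorem IsClassG.locallyBoundedVariationOn {g : ℝ → ℝ} (hg : IsClassG g) :
    LocallyBoundedVariationOn g (Ioo 0 1) := by
  intro a b ha hb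
  have h0 : 0 < min a (1 - b) := lt_min ha.1 (by linarith [hb.2])
  rcases lt_or_ge b a with hab | hab
  · rw [Icc_eq_empty (not_le.2 hab)]
    simp [BoundedVariationOn]
  have h1 : min a (1 - b) ≤ 1 / 2 := by
    rcases le_total a (1 / 2) with h | h
    · exact (min_le_left _ _).trans h
    · exact (min_le_right _ _).trans (by linarith)
  refine (hg.bddVar (min a (1 - b) / 2) ⟨by linarith, by linarith⟩).mono ?_
  rintro t ⟨-, ht⟩
  exact ⟨by linarith [min_le_left a (1 - b), ht.1], by linarith [min_le_right a (1 - b), ht.2]⟩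

/-- The variation of `g` from `1/2` to the point `t = sigmoid x`, where `sigmoid` is the logistic
increasing homeomorphism from `ℝ` onto `(0, 1)`. -/
def variationFun (g : ℝ → ℝ) (x : ℝ) : ℝ :=
  variationOnFromTo g (Ioo 0 1) (1 / 2) (Real.sigmoid x)

theorem IsClassG.monotone_variationFun {g : ℝ → ℝ} (hg : IsClassG g) :
    Monotone (variationFun g) := fun x y hxy =>
  variationOnFromTo.monotoneOn hg.locallyBoundedVariationOn (by norm_num)
    ⟨Real.sigmoid_pos x, Real.sigmoid_lt_one x⟩ ⟨Real.sigmoid_pos y, Real.sigmoid_lt_one y⟩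
    (Real.sigmoid_monotone hxy)

/-- The total variation measure `|g|` on `(0, 1)`: the Lebesgue-Stieltjes measure of the variation
function of `g`. It may be infinite near `0` and `1`, so the Stieltjes measure is built on `ℝ` in
the logistic coordinate and pushed forward to `(0, 1)`. It is the measure concentrated on `(0, 1)`
with `|g| [a, b) = Var (g; [a, b])` for `0 < a ≤ b < 1`, see `variationMeasure_Ico`. -/
def variationMeasure (g : ℝ → ℝ) (hg : IsClassG g) : Measure ℝ :=
  hg.monotone_variationFun.stieltjesFunction.measure.map Real.sigmoid

theorem variationMeasure_compl (g : ℝ → ℝ) (hg : IsClassG g) :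
    variationMeasure g hg (Ioo 0 1)ᶜ = 0 := by
  rw [variationMeasure, Measure.map_apply continuous_sigmoid.measurable measurableSet_Ioo.compl]
  have hpre : Real.sigmoid ⁻¹' (Ioo 0 1)ᶜ = ∅ := by
    ext x
    simp [Real.sigmoid_pos x, Real.sigmoid_lt_one x]
  rw [hpre, measure_empty]

theorem leftLim_variationFun {g : ℝ → ℝ} (hg : IsClassG g) (x : ℝ) :
    Function.leftLim hg.monotone_variationFun.stieltjesFunction x = variationFun g x := by
  have h1 : Function.leftLim hg.monotone_variationFun.stieltjesFunction x
      = Function.leftLim (variationFun g) x :=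
    leftLim_rightLim (hg.monotone_variationFun.tendsto_leftLim x)
  rw [h1]
  have hx : Real.sigmoid x ∈ Ioo (0 : ℝ) 1 := ⟨Real.sigmoid_pos x, Real.sigmoid_lt_one x⟩
  refine leftLim_eq_of_tendsto ?_
  have h2 : Tendsto g (𝓝[Ioo 0 1 ∩ Iio (Real.sigmoid x)] (Real.sigmoid x))
      (𝓝 (g (Real.sigmoid x))) :=
    Tendsto.mono_left (hg.leftCont _ hx) (nhdsWithin_mono _ fun t ht => mem_Iic.2 (le_of_lt ht.2))
  have h3 := variationOnFromTo.tendsto_left (a := 1 / 2) (by norm_num) hx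
    hg.locallyBoundedVariationOn h2
  rw [dist_self, sub_zero] at h3
  refine h3.comp (tendsto_nhdsWithin_iff.2 ⟨?_, ?_⟩)
  · exact continuous_sigmoid.continuousAt.mono_left nhdsWithin_le_nhds
  · filter_upwards [self_mem_nhdsWithin] with y hy
    exact ⟨⟨Real.sigmoid_pos y, Real.sigmoid_lt_one y⟩, Real.sigmoid_lt hy⟩

theorem variationMeasure_Ico (g : ℝ → ℝ) (hg : IsClassG g) {a b : ℝ} (ha : 0 < a) (hab : a ≤ b)
    (hb : b < 1) : variationMeasure g hg (Ico a b) = eVariationOn g (Icc a b) := by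
  have hai : a ∈ Ioo (0 : ℝ) 1 := ⟨ha, hab.trans_lt hb⟩
  have hbi : b ∈ Ioo (0 : ℝ) 1 := ⟨ha.trans_le hab, hb⟩
  obtain ⟨x, rfl⟩ : a ∈ range Real.sigmoid := by rwa [Real.range_sigmoid]
  obtain ⟨y, rfl⟩ : b ∈ range Real.sigmoid := by rwa [Real.range_sigmoid]
  have hpre : Real.sigmoid ⁻¹' Ico (Real.sigmoid x) (Real.sigmoid y) = Ico x y := by
    ext z
    exact and_congr Real.sigmoid_le_iff Real.sigmoid_lt_iff
  rw [variationMeasure, Measure.map_apply continuous_sigmoid.measurable measurableSet_Ico, hpre,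
    StieltjesFunction.measure_Ico, leftLim_variationFun hg, leftLim_variationFun hg,
    variationFun, variationFun, 
    variationOnFromTo.sub_right hg.locallyBoundedVariationOn (by norm_num) hbi hai,
    variationOnFromTo.eq_of_le _ _ hab,
    ENNReal.ofReal_toReal (hg.locallyBoundedVariationOn _ _ hai hbi),
    inter_eq_self_of_subset_right]
  exact fun z hz => ⟨ha.trans_le hz.1, hz.2.trans_lt hb⟩

/-! ### Scores, the statistic and its bounding functions -/

/-- The score function `J_n` of the constants `c n 1, …, c n n`: `J_n(t) = c n i` for
`(i - 1) / n < t ≤ i / n`, and `J_n(0) = c n 1`. -/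
def scoreFun (c : ℕ → ℕ → ℝ) (n : ℕ) (t : ℝ) : ℝ := c n (max 1 ⌈(n : ℝ) * t⌉₊)

/-- The integrand `u ↦ g (F_{n,b}⁻¹(u)) J_n(u)`. The function `g` lives on `(0, 1)`, while
`F_{n,b}⁻¹` may take values outside of it; there the integrand is `0`. -/
def kernelIntegrand (k : ℝ → ℝ) (g : ℝ → ℝ) (c : ℕ → ℕ → ℝ) {n : ℕ} (b : ℝ) (x : Fin n → ℝ)
    (u : ℝ) : ℝ :=
  (Ioo (0 : ℝ) 1).indicator g (leftInverse (kernelEstimator k b x) u) * scoreFun c n u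

/-- The kernel statistic `T_n = ∫_0^1 g (F_{n,b}⁻¹(u)) J_n(u) du`. -/
def kernelStatistic (k : ℝ → ℝ) (g : ℝ → ℝ) (c : ℕ → ℕ → ℝ) {n : ℕ} (b : ℝ) (x : Fin n → ℝ) : ℝ :=
  ∫ u in Ioo (0 : ℝ) 1, kernelIntegrand k g c b x u

/-- The order statistics `x_{n1} ≤ … ≤ x_{nn}` of the sample `x` (indexed from `0`). -/
def orderStat {n : ℕ} (x : Fin n → ℝ) (i : Fin n) : ℝ := x (Tuple.sort x i)

/-- The L-statistic `(1 / n) ∑_{i=1}^n g(x_{ni}) c_{ni}`. -/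
def lStatistic (g : ℝ → ℝ) (c : ℕ → ℕ → ℝ) {n : ℕ} (x : Fin n → ℝ) : ℝ :=
  1 / n * ∑ i : Fin n, g (orderStat x i) * c n (i + 1)

/-- `B(t) = M t^{-b₁} (1 - t)^{-b₂}`. -/
def boundB (M b₁ b₂ t : ℝ) : ℝ := M * t ^ (-b₁) * (1 - t) ^ (-b₂)

/-- `D(t) = M t^{-1 + b₁ + δ} (1 - t)^{-1 + b₂ + δ}`. -/
def boundD (M b₁ b₂ δ t : ℝ) : ℝ := M * t ^ (-1 + b₁ + δ) * (1 - t) ^ (-1 + b₂ + δ)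

/-- `h(t) = [t (1 - t)]^{1 - δ/2}`. -/
def weightH (δ t : ℝ) : ℝ := (t * (1 - t)) ^ (1 - δ / 2)

/-- Boundedness: `|g| ≤ D`, `|J_n| ≤ B` and `|J| ≤ B` on `(0, 1)`, and `∫_0^1 B h d|g| < ∞`. -/
structure BoundednessCondition (g J : ℝ → ℝ) (hg : IsClassG g) (c : ℕ → ℕ → ℝ)
    (M b₁ b₂ δ : ℝ) : Prop where
  abs_g_le : ∀ t ∈ Ioo (0 : ℝ) 1, |g t| ≤ boundD M b₁ b₂ δ t
  abs_score_le : ∀ n, 1 ≤ n → ∀ t ∈ Ioo (0 : ℝ) 1, |scoreFun c n t| ≤ boundB M b₁ b₂ t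
  abs_J_le : ∀ t ∈ Ioo (0 : ℝ) 1, |J t| ≤ boundB M b₁ b₂ t
  lintegral_lt_top :
    ∫⁻ t in Ioo (0 : ℝ) 1, ENNReal.ofReal (boundB M b₁ b₂ t * weightH δ t) ∂variationMeasure g hg < ∞

/-- Smoothness: at `|g|`-almost every `t`, `J` is continuous and `J_n → J` uniformly in some
neighbourhood of `t`; moreover `J_n(t) → J(t)` for Lebesgue-almost every `t ∈ (0, 1)` with
`g t ≠ 0`. The second part does not follow from the first where `|g|` vanishes, e.g. on an interval
of constancy of `g`; it does follow if Lebesgue measure on `(0, 1)` is absolutely continuous with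
respect to `|g|`. -/
structure SmoothnessCondition (g J : ℝ → ℝ) (hg : IsClassG g) (c : ℕ → ℕ → ℝ) : Prop where
  ae_variation : ∀ᵐ t ∂variationMeasure g hg,
    ContinuousAt J t ∧ ∃ U ∈ 𝓝 t, TendstoUniformlyOn (fun n => scoreFun c n) J atTop U
  ae_volume : ∀ᵐ t ∂volume.restrict (Ioo (0 : ℝ) 1),
    g t ≠ 0 → Tendsto (fun n => scoreFun c n t) atTop (𝓝 (J t))

end KernelLStat

end

open KernelLStat

noncomputable section

namespace KernelLStat

/-! Both statistics are of the form `∫₀¹ g(q_n(u)) J_n(u) du`, where `q_n` is the quantile function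
of the kernel estimator or of the empirical distribution. One deterministic theorem,
`tendsto_integral_indicator_mul_scoreFun`, therefore serves both, and probability only enters in
checking its hypotheses almost surely.

Pointwise convergence is easy: by the strong law at rational points the distribution functions tend
to the identity on `(0, 1)`, hence so do the `q_n`; `g` is continuous almost everywhere, and `J_n →
J` almost everywhere off the zeros of `g`. The difficulty is the passage to the limit under the
integral near `0` and `1`. There `|g(q) J_n(u)| ≤ D(q) B(v)`, with `v` the midpoint of the block of
`u`. At a common point `D B` has exponents `-1 + δ`, but at two points the product is controlled
only if `q` is not much larger than `v`, nor `1 - q` than `1 - v`. The comparison `q ≤ C v^(1-ε)`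
and its mirror image suffice: the loss `ε` is absorbed by `δ` (`boundD_mul_boundB_le`), leaving
endpoint weights of an exponent `γ < 1` at `q` and at `u`. These comparisons follow from
`FillsEnds`, that is from a Chernoff bound, a union bound over `j ≤ n` and Borel–Cantelli. They pass
to the kernel estimator because `0 < K(0) < 1`, which the mean zero condition forces.

It remains to have uniform integrability. For `γ < γ' < 1` the weight of exponent `γ` is at most a
constant plus a small multiple of that of exponent `γ'`, so it is enough to bound `∫ W(q_n(u)) du`,
where `W` is the latter. Quantile functions push Lebesgue measure to the underlying law, so this
integral is a sample average: of `W` itself in the empirical case, where the strong law applies, and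
of the kernel-smoothed `W` otherwise. The smoothed weight depends on `n`, but its mean is at most `∫
W` and its supremum is `O(n^ρ)` with `ρ < 1`, so an exponential inequality still bounds the averages
(`ae_eventually_sum_comp_le`). -/

/-! ### Endpoint weights -/

/-- The weight `t^{-γ} + (1 - t)^{-γ}` on `(0, 1)`. -/
def endpointWeight (γ t : ℝ) : ℝ := t ^ (-γ) + (1 - t) ^ (-γ)

theorem one_sub_mem_Ioo {t : ℝ} (ht : t ∈ Ioo (0 : ℝ) 1) : 1 - t ∈ Ioo (0 : ℝ) 1 :=
  ⟨by linarith [ht.2], by linarith [ht.1]⟩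

theorem endpointWeight_nonneg (γ : ℝ) {t : ℝ} (ht : t ∈ Ioo (0 : ℝ) 1) :
    0 ≤ endpointWeight γ t :=
  add_nonneg (Real.rpow_nonneg ht.1.le _) (Real.rpow_nonneg (one_sub_mem_Ioo ht).1.le _)

theorem measurable_endpointWeight (γ : ℝ) : Measurable (endpointWeight γ) := by
  unfold endpointWeight
  fun_prop

theorem integrableOn_endpointWeight {γ : ℝ} (hγ : γ < 1) :
    IntegrableOn (endpointWeight γ) (Ioo 0 1) := by
  have h1 : IntervalIntegrable (fun t : ℝ => t ^ (-γ)) volume 0 1 :=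
    intervalIntegral.intervalIntegrable_rpow' (by linarith)
  have h2 : IntervalIntegrable (fun t : ℝ => (1 - t) ^ (-γ)) volume 0 1 := by
    have := (h1.comp_sub_left 1).symm
    simpa using this
  have h3 := h1.add h2
  rw [intervalIntegrable_iff_integrableOn_Ioo_of_le zero_le_one] at h3
  exact h3

/-- Split at `t = β`: above it the power is bounded, below it the spare factor `t^(γ'-γ)` is small.
-/
theorem rpow_neg_le_add {γ γ' β t : ℝ} (hγ : 0 ≤ γ) (hγγ' : γ ≤ γ') (hβ : 0 < β) (ht : 0 < t) :
    t ^ (-γ) ≤ β ^ (-γ) + β ^ (γ' - γ) * t ^ (-γ') := by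
  have e1 : 0 ≤ β ^ (-γ) := Real.rpow_nonneg hβ.le _
  have e2 : 0 ≤ β ^ (γ' - γ) * t ^ (-γ') := by positivity
  rcases le_total β t with h | h
  · have := Real.rpow_le_rpow_of_nonpos hβ h (neg_nonpos.2 hγ)
    linarith
  · have : t ^ (-γ) = t ^ (γ' - γ) * t ^ (-γ') := by
      rw [← Real.rpow_add ht]; congr 1; ring
    have h4 : t ^ (γ' - γ) ≤ β ^ (γ' - γ) := Real.rpow_le_rpow ht.le h (by linarith)
    have h5 : 0 ≤ t ^ (-γ') := Real.rpow_nonneg ht.le _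
    nlinarith

/-- A smaller exponent is negligible against a larger one, up to a constant. -/
theorem endpointWeight_le_add {γ γ' β t : ℝ} (hγ : 0 ≤ γ) (hγγ' : γ ≤ γ') (hβ : 0 < β)
    (ht : t ∈ Ioo (0 : ℝ) 1) :
    endpointWeight γ t ≤ 2 * β ^ (-γ) + β ^ (γ' - γ) * endpointWeight γ' t := by
  have h1 := rpow_neg_le_add hγ hγγ' hβ ht.1
  have h2 := rpow_neg_le_add hγ hγγ' hβ (one_sub_mem_Ioo ht).1
  unfold endpointWeight
  linarith

theorem endpointWeight_le_two_mul {γ u v : ℝ} (hγ0 : 0 ≤ γ) (hγ1 : γ ≤ 1)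
    (hu : u ∈ Ioo (0 : ℝ) 1) (h1 : u ≤ 2 * v) (h2 : 1 - u ≤ 2 * (1 - v)) :
    endpointWeight γ v ≤ 2 * endpointWeight γ u := by
  have key : ∀ {a b : ℝ}, 0 < a → a ≤ 2 * b → b ^ (-γ) ≤ 2 * a ^ (-γ) := by
    intro a b ha hab
    have h3 : b ^ (-γ) ≤ (2⁻¹ * a) ^ (-γ) :=
      Real.rpow_le_rpow_of_nonpos (by positivity) (by linarith) (by linarith)
    rw [Real.mul_rpow (by norm_num) ha.le, Real.inv_rpow (by norm_num),
      Real.rpow_neg zero_le_two, inv_inv] at h3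
    have h4 : (2 : ℝ) ^ γ ≤ 2 ^ (1 : ℝ) := Real.rpow_le_rpow_of_exponent_le (by norm_num) hγ1
    rw [Real.rpow_one] at h4
    exact h3.trans (mul_le_mul_of_nonneg_right h4 (Real.rpow_nonneg ha.le _))
  have h3 := key hu.1 h1
  have h4 := key (one_sub_mem_Ioo hu).1 h2
  unfold endpointWeight
  linarith

/-! ### The product `D(q) B(v)` -/

theorem boundB_one_sub (M b₁ b₂ t : ℝ) : boundB M b₁ b₂ (1 - t) = boundB M b₂ b₁ t := by
  unfold boundB
  rw [sub_sub_cancel]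
  ring

theorem boundD_one_sub (M b₁ b₂ δ t : ℝ) : boundD M b₁ b₂ δ (1 - t) = boundD M b₂ b₁ δ t := by
  unfold boundD
  rw [sub_sub_cancel]
  ring

theorem endpointWeight_one_sub (γ t : ℝ) : endpointWeight γ (1 - t) = endpointWeight γ t := by
  unfold endpointWeight
  rw [sub_sub_cancel]
  ring

theorem rpow_le_two_rpow_abs {x : ℝ} (hx : x ∈ Icc (1 / 2 : ℝ) 1) (a : ℝ) :
    x ^ a ≤ 2 ^ |a| := by
  have hx0 : 0 < x := by linarith [hx.1]
  rcases le_total 0 a with ha | ha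
  · exact (Real.rpow_le_one hx0.le hx.2 ha).trans
      (Real.one_le_rpow (by norm_num) (abs_nonneg a))
  · rw [abs_of_nonpos ha]
    calc x ^ a ≤ (1 / 2) ^ a := Real.rpow_le_rpow_of_nonpos (by norm_num) hx.1 ha
      _ = 2 ^ (-a) := by rw [one_div, Real.inv_rpow (by norm_num), Real.rpow_neg (by norm_num)]

/-- If the exponent of `q` is nonnegative, replace `q` by `C v^(1-ε)`; the resulting exponent of `v`
is `-1 + δ + ε - ε (b₁ + δ) ≥ -1 + δ/2 ≥ -γ`. If it is nonpositive, both factors increase on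
replacing `q` and `v` by their minimum, and no comparison is needed. -/
theorem rpow_mul_rpow_neg_le {b₁ δ ε γ C q v : ℝ} (hb₁ : 0 < b₁) (hε0 : 0 < ε)
    (hεδ : ε * (b₁ + δ) ≤ δ / 2) (hδ : 0 < δ) (hγ : 1 - δ / 2 ≤ γ) (hC : 1 ≤ C)
    (hq : q ∈ Ioo (0 : ℝ) 1) (hv : v ∈ Ioo (0 : ℝ) 1) (hqv : q ≤ C * v ^ (1 - ε)) :
    q ^ (-1 + b₁ + δ) * v ^ (-b₁) ≤ C ^ (b₁ + δ) * (q ^ (-γ) + v ^ (-γ)) := by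
  have hC0 : 0 < C := by linarith
  have hC1 : 1 ≤ C ^ (b₁ + δ) := Real.one_le_rpow hC (by linarith)
  have hqγ : 0 ≤ q ^ (-γ) := Real.rpow_nonneg hq.1.le _
  have hvγ : 0 ≤ v ^ (-γ) := Real.rpow_nonneg hv.1.le _
  rcases le_total 0 (-1 + b₁ + δ) with ha | ha
  · have h1 : q ^ (-1 + b₁ + δ) ≤ C ^ (b₁ + δ) * v ^ ((1 - ε) * (-1 + b₁ + δ)) := by
      calc q ^ (-1 + b₁ + δ) ≤ (C * v ^ (1 - ε)) ^ (-1 + b₁ + δ) :=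
            Real.rpow_le_rpow hq.1.le hqv ha
        _ = C ^ (-1 + b₁ + δ) * v ^ ((1 - ε) * (-1 + b₁ + δ)) := by
            rw [Real.mul_rpow hC0.le (Real.rpow_nonneg hv.1.le _), Real.rpow_mul hv.1.le]
        _ ≤ _ := by
            refine mul_le_mul_of_nonneg_right ?_ (Real.rpow_nonneg hv.1.le _)
            exact Real.rpow_le_rpow_of_exponent_le hC (by linarith)
    have h2 : v ^ ((1 - ε) * (-1 + b₁ + δ)) * v ^ (-b₁) ≤ v ^ (-γ) := by
      rw [← Real.rpow_add hv.1]
      refine Real.rpow_le_rpow_of_exponent_ge hv.1 hv.2.le ?_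
      nlinarith
    calc q ^ (-1 + b₁ + δ) * v ^ (-b₁)
        ≤ C ^ (b₁ + δ) * v ^ ((1 - ε) * (-1 + b₁ + δ)) * v ^ (-b₁) :=
          mul_le_mul_of_nonneg_right h1 (Real.rpow_nonneg hv.1.le _)
      _ = C ^ (b₁ + δ) * (v ^ ((1 - ε) * (-1 + b₁ + δ)) * v ^ (-b₁)) := by ring
      _ ≤ C ^ (b₁ + δ) * (q ^ (-γ) + v ^ (-γ)) := by gcongr; linarith
  · have hm0 : 0 < min q v := lt_min hq.1 hv.1
    have hm1 : min q v ≤ 1 := (min_le_left _ _).trans hq.2.le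
    have h1 : q ^ (-1 + b₁ + δ) * v ^ (-b₁) ≤ min q v ^ (-γ) := by
      calc q ^ (-1 + b₁ + δ) * v ^ (-b₁) ≤ min q v ^ (-1 + b₁ + δ) * min q v ^ (-b₁) := by
            refine mul_le_mul ?_ ?_ (Real.rpow_nonneg hv.1.le _) (Real.rpow_nonneg hm0.le _)
            · exact Real.rpow_le_rpow_of_nonpos hm0 (min_le_left _ _) ha
            · exact Real.rpow_le_rpow_of_nonpos hm0 (min_le_right _ _) (by linarith)
        _ = min q v ^ (-1 + δ) := by rw [← Real.rpow_add hm0]; congr 1; ring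
        _ ≤ min q v ^ (-γ) := Real.rpow_le_rpow_of_exponent_ge hm0 hm1 (by linarith)
    have h2 : min q v ^ (-γ) ≤ q ^ (-γ) + v ^ (-γ) := by
      rcases min_choice q v with h | h <;> rw [h] <;> linarith
    nlinarith

/-- For `q ≤ 1/2` the second comparison keeps `v` away from `1`, so the factors in `1 - q` and `1 -
v` are bounded and only the endpoint `0` matters. -/
theorem boundD_mul_boundB_le_of_le_half {M b₁ b₂ δ ε γ C : ℝ} (hM : 0 < M) (hb₁ : 0 < b₁)
    (hb₂ : 0 < b₂) (hδ : 0 < δ) (hε0 : 0 < ε) (hε1 : ε < 1) (hεδ : ε * (b₁ + δ) ≤ δ / 2)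
    (hγ : 1 - δ / 2 ≤ γ) (hC : 1 ≤ C) :
    ∃ A : ℝ, 0 ≤ A ∧ ∀ q ∈ Ioo (0 : ℝ) 1, ∀ v ∈ Ioo (0 : ℝ) 1, q ≤ 1 / 2 →
      q ≤ C * v ^ (1 - ε) → 1 - q ≤ C * (1 - v) ^ (1 - ε) →
      boundD M b₁ b₂ δ q * boundB M b₁ b₂ v ≤ A * (endpointWeight γ q + endpointWeight γ v) := by
  have hC0 : 0 < C := by linarith
  -- Solves `1/2 = C c^(1-ε)`, hence is a lower bound for `1 - v`.
  set c : ℝ := (1 / (2 * C)) ^ (1 / (1 - ε)) with hc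
  have hc0 : 0 < c := by positivity
  refine ⟨M * M * 2 ^ |-1 + b₂ + δ| * c ^ (-b₂) * C ^ (b₁ + δ), by positivity, ?_⟩
  intro q hq v hv hq2 h1 h2
  have hv1 := one_sub_mem_Ioo hv
  have hq1 := one_sub_mem_Ioo hq
  have hcv : c ≤ 1 - v := by
    have h3 : 1 / (2 * C) ≤ (1 - v) ^ (1 - ε) := by
      rw [div_le_iff₀ (by positivity)]
      linarith
    calc c ≤ ((1 - v) ^ (1 - ε)) ^ (1 / (1 - ε)) :=
          Real.rpow_le_rpow (by positivity) h3 (by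
            have : 0 < 1 - ε := by linarith
            positivity)
      _ = 1 - v := by
          rw [← Real.rpow_mul hv1.1.le, mul_one_div_cancel (by linarith), Real.rpow_one]
  have h4 : (1 - v) ^ (-b₂) ≤ c ^ (-b₂) := Real.rpow_le_rpow_of_nonpos hc0 hcv (by linarith)
  have h5 : (1 - q) ^ (-1 + b₂ + δ) ≤ 2 ^ |-1 + b₂ + δ| :=
    rpow_le_two_rpow_abs ⟨by linarith, hq1.2.le⟩ _
  have h6 := rpow_mul_rpow_neg_le hb₁ hε0 hεδ hδ hγ hC hq hv h1
  have hq0 : 0 ≤ q ^ (-1 + b₁ + δ) := Real.rpow_nonneg hq.1.le _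
  have hv0 : 0 ≤ v ^ (-b₁) := Real.rpow_nonneg hv.1.le _
  have hq0' : 0 ≤ (1 - q) ^ (-1 + b₂ + δ) := Real.rpow_nonneg hq1.1.le _
  have hv0' : 0 ≤ (1 - v) ^ (-b₂) := Real.rpow_nonneg hv1.1.le _
  have e1 : 0 ≤ (1 - q) ^ (-γ) := Real.rpow_nonneg hq1.1.le _
  have e2 : 0 ≤ (1 - v) ^ (-γ) := Real.rpow_nonneg hv1.1.le _
  calc boundD M b₁ b₂ δ q * boundB M b₁ b₂ v
      = M * M * (1 - q) ^ (-1 + b₂ + δ) * (1 - v) ^ (-b₂) * (q ^ (-1 + b₁ + δ) * v ^ (-b₁)) := by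
        unfold boundD boundB; ring
    _ ≤ M * M * 2 ^ |-1 + b₂ + δ| * c ^ (-b₂) * (C ^ (b₁ + δ) * (q ^ (-γ) + v ^ (-γ))) := by
        gcongr
    _ = M * M * 2 ^ |-1 + b₂ + δ| * c ^ (-b₂) * C ^ (b₁ + δ) * (q ^ (-γ) + v ^ (-γ)) := by ring
    _ ≤ _ := by
        unfold endpointWeight
        gcongr <;> linarith

/-- If `q` is, up to a small power, at most of the order of `v`, and `1 - q` of `1 - v`, then
`D(q) B(v)` is dominated by endpoint weights with exponent less than one. -/
theorem boundD_mul_boundB_le {M b₁ b₂ δ ε γ C : ℝ} (hM : 0 < M) (hb₁ : 0 < b₁)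
    (hb₂ : 0 < b₂) (hδ : 0 < δ) (hε0 : 0 < ε) (hε1 : ε < 1) (hεδ : ε * (b₁ + b₂ + δ) ≤ δ / 2)
    (hγ : 1 - δ / 2 ≤ γ) (hC : 1 ≤ C) :
    ∃ A : ℝ, 0 ≤ A ∧ ∀ q ∈ Ioo (0 : ℝ) 1, ∀ v ∈ Ioo (0 : ℝ) 1,
      q ≤ C * v ^ (1 - ε) → 1 - q ≤ C * (1 - v) ^ (1 - ε) →
      boundD M b₁ b₂ δ q * boundB M b₁ b₂ v ≤ A * (endpointWeight γ q + endpointWeight γ v) := by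
  obtain ⟨A₁, hA₁, h₁⟩ := boundD_mul_boundB_le_of_le_half (b₂ := b₂) hM hb₁ hb₂ hδ hε0 hε1
    (by nlinarith) hγ hC
  obtain ⟨A₂, hA₂, h₂⟩ := boundD_mul_boundB_le_of_le_half (b₂ := b₁) hM hb₂ hb₁ hδ hε0 hε1
    (by nlinarith) hγ hC
  refine ⟨A₁ + A₂, by positivity, fun q hq v hv hqv hqv' => ?_⟩
  have hw := add_nonneg (endpointWeight_nonneg γ hq) (endpointWeight_nonneg γ hv)
  rcases le_total q (1 / 2) with h | h
  · exact (h₁ q hq v hv h hqv hqv').trans (by gcongr; linarith)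
  -- Reflection `t ↦ 1 - t` exchanges `b₁` and `b₂`.
  · have := h₂ (1 - q) (one_sub_mem_Ioo hq) (1 - v) (one_sub_mem_Ioo hv) (by linarith) hqv'
      (by simpa using hqv)
    rw [boundD_one_sub, boundB_one_sub, endpointWeight_one_sub, endpointWeight_one_sub] at this
    exact this.trans (by gcongr; linarith)

/-! ### Scores are constant on blocks -/

/-- The midpoint of the block `((i - 1) / n, i / n]` that contains `u`. -/
def blockMid (n : ℕ) (u : ℝ) : ℝ := (⌈(n : ℝ) * u⌉₊ - 1 / 2) / n

theorem one_le_ceil {n : ℕ} (hn : 1 ≤ n) {u : ℝ} (hu : u ∈ Ioo (0 : ℝ) 1) :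
    1 ≤ ⌈(n : ℝ) * u⌉₊ := by
  have : (0 : ℝ) < n := by exact_mod_cast hn
  exact Nat.ceil_pos.2 (mul_pos this hu.1)

theorem ceil_le {n : ℕ} {u : ℝ} (hu : u ∈ Ioo (0 : ℝ) 1) : ⌈(n : ℝ) * u⌉₊ ≤ n := by
  refine Nat.ceil_le.2 ?_
  nlinarith [hu.2, (Nat.cast_nonneg n : (0 : ℝ) ≤ n)]

theorem blockMid_mem_Ioo {n : ℕ} (hn : 1 ≤ n) {u : ℝ} (hu : u ∈ Ioo (0 : ℝ) 1) :
    blockMid n u ∈ Ioo (0 : ℝ) 1 := by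
  have h0 : (0 : ℝ) < n := by exact_mod_cast hn
  have h1 : (1 : ℝ) ≤ ⌈(n : ℝ) * u⌉₊ := by exact_mod_cast one_le_ceil hn hu
  have h2 : (⌈(n : ℝ) * u⌉₊ : ℝ) ≤ n := by exact_mod_cast ceil_le hu
  unfold blockMid
  constructor
  · apply div_pos _ h0; linarith
  · rw [div_lt_one h0]; linarith

/-- This allows `B` to be evaluated at the midpoint, at distance at least `1 / (2n)` from both ends,
instead of at `u`, which may be arbitrarily close to them. -/
theorem scoreFun_blockMid (c : ℕ → ℕ → ℝ) {n : ℕ} (hn : 1 ≤ n) {u : ℝ}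
    (hu : u ∈ Ioo (0 : ℝ) 1) : scoreFun c n (blockMid n u) = scoreFun c n u := by
  have h0 : (0 : ℝ) < n := by exact_mod_cast hn
  have h1 := one_le_ceil hn hu
  unfold scoreFun
  congr 2
  rw [blockMid, mul_div_cancel₀ _ h0.ne', Nat.ceil_eq_iff (by omega)]
  rw [Nat.cast_sub h1]
  constructor <;> norm_num

theorem ceil_div_le_blockMid {n : ℕ} (hn : 1 ≤ n) {u : ℝ} (hu : u ∈ Ioo (0 : ℝ) 1) :
    (⌈(n : ℝ) * u⌉₊ : ℝ) / n ≤ 2 * blockMid n u := by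
  have h0 : (0 : ℝ) < n := by exact_mod_cast hn
  have h1 : (1 : ℝ) ≤ ⌈(n : ℝ) * u⌉₊ := by exact_mod_cast one_le_ceil hn hu
  rw [blockMid, ← mul_div_assoc]
  gcongr
  linarith

theorem sub_ceil_div_le_blockMid {n : ℕ} (hn : 1 ≤ n) {u : ℝ} (hu : u ∈ Ioo (0 : ℝ) 1) :
    ((n : ℝ) - ⌈(n : ℝ) * u⌉₊ + 1) / n ≤ 2 * (1 - blockMid n u) := by
  have h0 : (0 : ℝ) < n := by exact_mod_cast hn
  have h2 : (⌈(n : ℝ) * u⌉₊ : ℝ) ≤ n := by exact_mod_cast ceil_le hu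
  rw [blockMid, div_le_iff₀ h0, mul_assoc, sub_mul, div_mul_cancel₀ _ h0.ne']
  linarith

theorem le_two_mul_blockMid {n : ℕ} (hn : 1 ≤ n) {u : ℝ} (hu : u ∈ Ioo (0 : ℝ) 1) :
    u ≤ 2 * blockMid n u := by
  have h0 : (0 : ℝ) < n := by exact_mod_cast hn
  refine le_trans ?_ (ceil_div_le_blockMid hn hu)
  rw [le_div_iff₀ h0, mul_comm]
  exact Nat.le_ceil _

theorem one_sub_le_two_mul_blockMid {n : ℕ} (hn : 1 ≤ n) {u : ℝ} (hu : u ∈ Ioo (0 : ℝ) 1) :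
    1 - u ≤ 2 * (1 - blockMid n u) := by
  have h0 : (0 : ℝ) < n := by exact_mod_cast hn
  refine le_trans ?_ (sub_ceil_div_le_blockMid hn hu)
  rw [le_div_iff₀ h0]
  have := Nat.ceil_lt_add_one (mul_pos h0 hu.1).le
  linarith

/-! ### A convergence theorem for uniformly integrable sequences -/

theorem abs_sub_clamp_le {x K y : ℝ} (hK : 0 ≤ K) (hy : 0 ≤ y) (h : |x| ≤ K + y) :
    |x - max (-K) (min x K)| ≤ y := by
  rw [abs_le] at h ⊢
  rcases le_total x K with h1 | h1
  · rw [min_eq_left h1]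
    rcases le_total (-K) x with h2 | h2
    · rw [max_eq_right h2]
      constructor <;> linarith
    · rw [max_eq_left h2]
      constructor <;> linarith
  · rw [min_eq_right h1, max_eq_right (by linarith)]
    constructor <;> linarith

theorem abs_clamp_le {x K : ℝ} (hK : 0 ≤ K) : |max (-K) (min x K)| ≤ K :=
  abs_le.2 ⟨le_max_left _ _, max_le (by linarith) (min_le_right _ _)⟩

theorem continuous_clamp (K : ℝ) : Continuous fun x : ℝ => max (-K) (min x K) := by fun_prop

/-- Truncation at level `K` costs at most `η G` pointwise, an error uniform over all functions with
the same `K`, `η` and `C`. -/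
theorem abs_integral_sub_integral_clamp_le {α : Type*} [MeasurableSpace α] {μ : Measure α}
    [IsFiniteMeasure μ] {f G : α → ℝ} {K η C : ℝ} (hK : 0 ≤ K) (hη : 0 ≤ η)
    (hf : AEStronglyMeasurable f μ) (hG : Integrable G μ) (hG0 : ∀ᵐ a ∂μ, 0 ≤ G a)
    (hGC : ∫ a, G a ∂μ ≤ C) (hle : ∀ᵐ a ∂μ, |f a| ≤ K + η * G a) :
    |(∫ a, f a ∂μ) - ∫ a, max (-K) (min (f a) K) ∂μ| ≤ η * C := by
  have hfi : Integrable f μ :=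
    ((integrable_const K).add (hG.const_mul η)).mono' hf hle
  have hci : Integrable (fun a => max (-K) (min (f a) K)) μ :=
    (integrable_const K).mono' ((continuous_clamp K).comp_aestronglyMeasurable hf)
      (Eventually.of_forall fun a => abs_clamp_le hK)
  rw [← integral_sub hfi hci]
  calc |∫ a, (f a - max (-K) (min (f a) K)) ∂μ|
      ≤ ∫ a, |f a - max (-K) (min (f a) K)| ∂μ := abs_integral_le_integral_abs
    _ ≤ ∫ a, η * G a ∂μ := by
        refine integral_mono_ae (hfi.sub hci).abs (hG.const_mul η) ?_
        filter_upwards [hle, hG0] with a h1 h2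
        exact abs_sub_clamp_le hK (mul_nonneg hη h2) h1
    _ = η * ∫ a, G a ∂μ := integral_const_mul _ _
    _ ≤ η * C := by gcongr

/-- Integrals converge along an almost everywhere convergent sequence that is bounded, up to a
constant, by arbitrarily small multiples of functions with bounded integrals. -/
theorem tendsto_integral_of_abs_le_add_mul {α : Type*} [MeasurableSpace α] {μ : Measure α}
    [IsFiniteMeasure μ] {f G : ℕ → α → ℝ} {f₀ G₀ : α → ℝ} {C : ℝ}
    (hf : ∀ n, AEStronglyMeasurable (f n) μ) (hf₀ : AEStronglyMeasurable f₀ μ)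
    (hG : ∀ᶠ n in atTop, Integrable (G n) μ) (hG0 : ∀ n, ∀ᵐ a ∂μ, 0 ≤ G n a)
    (hGC : ∀ᶠ n in atTop, ∫ a, G n a ∂μ ≤ C)
    (hG₀ : Integrable G₀ μ) (hG₀0 : ∀ᵐ a ∂μ, 0 ≤ G₀ a) (hG₀C : ∫ a, G₀ a ∂μ ≤ C)
    (hle : ∀ η : ℝ, 0 < η → ∃ K : ℝ, 0 ≤ K ∧
      (∀ᶠ n in atTop, ∀ᵐ a ∂μ, |f n a| ≤ K + η * G n a) ∧ ∀ᵐ a ∂μ, |f₀ a| ≤ K + η * G₀ a)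
    (hlim : ∀ᵐ a ∂μ, Tendsto (fun n => f n a) atTop (𝓝 (f₀ a))) :
    Tendsto (fun n => ∫ a, f n a ∂μ) atTop (𝓝 (∫ a, f₀ a ∂μ)) := by
  rw [Metric.tendsto_atTop']
  intro ε hε
  have hC : 0 ≤ C := (integral_nonneg_of_ae hG₀0).trans hG₀C
  -- Two truncation errors of at most `η C` and the error of the truncated integrals, which converge
  -- by bounded convergence, add up to less than `ε`.
  set η : ℝ := ε / (3 * (C + 1)) with hη
  have hη0 : 0 < η := by positivity
  have hηC : η * C < ε / 3 := by
    have : η * (C + 1) = ε / 3 := by rw [hη]; field_simp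
    linarith
  obtain ⟨K, hK, h1, h2⟩ := hle η hη0
  have h3 : Tendsto (fun n => ∫ a, max (-K) (min (f n a) K) ∂μ) atTop
      (𝓝 (∫ a, max (-K) (min (f₀ a) K) ∂μ)) := by
    refine tendsto_integral_of_dominated_convergence (fun _ => K)
      (fun n => (continuous_clamp K).comp_aestronglyMeasurable (hf n)) (integrable_const K)
      (fun n => Eventually.of_forall fun a => abs_clamp_le hK) ?_
    filter_upwards [hlim] with a ha
    exact ((continuous_clamp K).tendsto _).comp ha
  have h4 := abs_integral_sub_integral_clamp_le hK hη0.le hf₀ hG₀ hG₀0 hG₀C h2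
  have h5 : ∀ᶠ n in atTop, |(∫ a, f n a ∂μ) - ∫ a, f₀ a ∂μ| < ε := by
    filter_upwards [h1, hG, hGC, Metric.tendsto_nhds.1 h3 (ε / 3) (by positivity)]
      with n g1 g2 g3 g4
    have h6 := abs_integral_sub_integral_clamp_le hK hη0.le (hf n) g2 (hG0 n) g3 g1
    rw [Real.dist_eq] at g4
    rw [abs_le] at h4 h6
    rw [abs_lt] at g4 ⊢
    constructor <;> linarith [h4.1, h4.2, h6.1, h6.2, g4.1, g4.2]
  obtain ⟨N, hN⟩ := eventually_atTop.1 h5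
  exact ⟨N, fun n hn => hN n hn.le⟩

/-! ### Regularity of `g` -/

/-- A function of locally bounded variation is a difference of two monotone ones. -/
theorem IsClassG.measurable_indicator {g : ℝ → ℝ} (hg : IsClassG g) :
    Measurable ((Ioo (0 : ℝ) 1).indicator g) := by
  obtain ⟨p, r, hp, hr, rfl⟩ := hg.locallyBoundedVariationOn.exists_monotoneOn_sub_monotoneOn
  have key : ∀ {p : ℝ → ℝ}, MonotoneOn p (Ioo 0 1) → Measurable ((Ioo (0 : ℝ) 1).indicator p) := by
    intro p hp
    refine measurable_of_measurable_union_cover (Ioo (0 : ℝ) 1) (Ioo (0 : ℝ) 1)ᶜ measurableSet_Ioo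
      measurableSet_Ioo.compl (union_compl_self _).ge ?_ ?_
    · have : Monotone fun x : Ioo (0 : ℝ) 1 => p x := fun x y hxy => hp x.2 y.2 hxy
      simpa only [indicator_of_mem, Subtype.coe_prop] using this.measurable
    · have : (fun x : ((Ioo (0 : ℝ) 1)ᶜ : Set ℝ) => (Ioo (0 : ℝ) 1).indicator p x) = fun _ => 0 :=
        funext fun x => indicator_of_notMem x.2 p
      rw [this]
      exact measurable_const
  rw [Set.indicator_sub']
  exact (key hp).sub (key hr)

/-- Functions of locally bounded variation are differentiable almost everywhere. -/
theorem IsClassG.ae_continuousAt {g : ℝ → ℝ} (hg : IsClassG g) :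
    ∀ᵐ t ∂volume.restrict (Ioo (0 : ℝ) 1), ContinuousAt g t := by
  rw [ae_restrict_iff' measurableSet_Ioo]
  filter_upwards [hg.locallyBoundedVariationOn.ae_differentiableWithinAt_of_mem] with t ht hmem
  exact (ht hmem).continuousWithinAt.continuousAt (Ioo_mem_nhds hmem.1 hmem.2)

/-! ### Convergence of `∫ g(q_n(u)) J_n(u) du` -/

theorem measurable_scoreFun (c : ℕ → ℕ → ℝ) (n : ℕ) : Measurable (scoreFun c n) := by
  unfold scoreFun
  have : Measurable fun t : ℝ => ⌈(n : ℝ) * t⌉₊ :=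
    Nat.measurable_ceil.comp (measurable_const.mul measurable_id)
  exact (measurable_of_countable (fun m : ℕ => c n (max 1 m))).comp this

/-- Exponents that make `D(q) B(v)` integrable. -/
structure AdmissibleExponents (b₁ b₂ δ ε γ : ℝ) : Prop where
  eps_pos : 0 < ε
  eps_lt_one : ε < 1
  eps_mul_le : ε * (b₁ + b₂ + δ) ≤ δ / 2
  le_gamma : 1 - δ / 2 ≤ γ
  gamma_pos : 0 < γ
  gamma_lt_one : γ < 1

theorem exists_admissibleExponents {b₁ b₂ δ : ℝ} (hb₁ : 0 < b₁) (hb₂ : 0 < b₂) (hδ : 0 < δ) :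
    ∃ ε γ : ℝ, AdmissibleExponents b₁ b₂ δ ε γ := by
  -- This `ε` gives equality in `eps_mul_le`; the maximum with `1/2` keeps `γ` positive when `δ ≥
  -- 2`.
  refine ⟨δ / (2 * (b₁ + b₂ + δ)), max (1 - δ / 2) (1 / 2), by positivity, ?_, ?_, le_max_left _ _,
    lt_max_of_lt_right (by norm_num), max_lt (by linarith) (by norm_num)⟩
  · rw [div_lt_one (by positivity)]
    linarith
  · apply le_of_eq
    field_simp

section Convergence

variable {g J : ℝ → ℝ} {hg : IsClassG g} {c : ℕ → ℕ → ℝ} {M b₁ b₂ δ ε γ : ℝ}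

/-- The integrand `g(q) J_n(u)` is dominated by endpoint weights. -/
theorem exists_abs_indicator_mul_scoreFun_le (hM : 0 < M) (hb₁ : 0 < b₁) (hb₂ : 0 < b₂)
    (hδ : 0 < δ) (hbound : BoundednessCondition g J hg c M b₁ b₂ δ)
    (hadm : AdmissibleExponents b₁ b₂ δ ε γ) {C : ℝ} (hC : 1 ≤ C) :
    ∃ A : ℝ, 0 ≤ A ∧ ∀ n, 1 ≤ n → ∀ u ∈ Ioo (0 : ℝ) 1, ∀ q : ℝ,
      (q ∈ Ioo (0 : ℝ) 1 →
        q ≤ C * blockMid n u ^ (1 - ε) ∧ 1 - q ≤ C * (1 - blockMid n u) ^ (1 - ε)) →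
      |(Ioo (0 : ℝ) 1).indicator g q * scoreFun c n u| ≤
        A * ((Ioo (0 : ℝ) 1).indicator (endpointWeight γ) q + 2 * endpointWeight γ u) := by
  obtain ⟨A, hA, h⟩ := boundD_mul_boundB_le hM hb₁ hb₂ hδ hadm.eps_pos hadm.eps_lt_one
    hadm.eps_mul_le hadm.le_gamma hC
  refine ⟨A, hA, fun n hn u hu q hq => ?_⟩
  have hw := endpointWeight_nonneg γ hu
  by_cases hq01 : q ∈ Ioo (0 : ℝ) 1
  · obtain ⟨h1, h2⟩ := hq hq01
    have hv := blockMid_mem_Ioo hn hu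
    rw [indicator_of_mem hq01, indicator_of_mem hq01, abs_mul, ← scoreFun_blockMid c hn hu]
    have hgD := hbound.abs_g_le q hq01
    calc |g q| * |scoreFun c n (blockMid n u)|
        ≤ boundD M b₁ b₂ δ q * boundB M b₁ b₂ (blockMid n u) :=
          mul_le_mul hgD (hbound.abs_score_le n hn _ hv) (abs_nonneg _) ((abs_nonneg _).trans hgD)
      _ ≤ A * (endpointWeight γ q + endpointWeight γ (blockMid n u)) := h q hq01 _ hv h1 h2
      _ ≤ _ := by
        gcongr
        exact endpointWeight_le_two_mul hadm.gamma_pos.le hadm.gamma_lt_one.le hu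
          (le_two_mul_blockMid hn hu) (one_sub_le_two_mul_blockMid hn hu)
  · rw [indicator_of_notMem hq01, indicator_of_notMem hq01]
    simp only [zero_mul, abs_zero, zero_add]
    positivity

/-- The diagonal case `q = v = u` with `C = 1`, since `u ≤ u^(1-ε)` on `(0, 1)`. -/
theorem exists_abs_mul_le (hM : 0 < M) (hb₁ : 0 < b₁) (hb₂ : 0 < b₂)
    (hδ : 0 < δ) (hbound : BoundednessCondition g J hg c M b₁ b₂ δ)
    (hadm : AdmissibleExponents b₁ b₂ δ ε γ) :
    ∃ A : ℝ, 0 ≤ A ∧ ∀ u ∈ Ioo (0 : ℝ) 1, |J u * g u| ≤ A * (2 * endpointWeight γ u) := by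
  obtain ⟨A, hA, h⟩ := boundD_mul_boundB_le hM hb₁ hb₂ hδ hadm.eps_pos hadm.eps_lt_one
    hadm.eps_mul_le hadm.le_gamma le_rfl
  have hle : ∀ u ∈ Ioo (0 : ℝ) 1, u ≤ 1 * u ^ (1 - ε) := fun u hu => by
    have := Real.rpow_le_rpow_of_exponent_ge hu.1 hu.2.le
      (show 1 - ε ≤ 1 by linarith [hadm.eps_pos])
    rwa [Real.rpow_one, ← one_mul (u ^ (1 - ε))] at this
  refine ⟨A, hA, fun u hu => ?_⟩
  have hgD := hbound.abs_g_le u hu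
  rw [abs_mul, mul_comm, two_mul]
  exact (mul_le_mul hgD (hbound.abs_J_le u hu) (abs_nonneg _) ((abs_nonneg _).trans hgD)).trans
    (h u hu u hu (hle u hu) (hle _ (one_sub_mem_Ioo hu)))

theorem aestronglyMeasurable_mul (hg : IsClassG g)
    (hJ : Measurable fun t : Ioo (0 : ℝ) 1 => J t) :
    AEStronglyMeasurable (fun t => J t * g t) (volume.restrict (Ioo (0 : ℝ) 1)) := by
  have h1 : AEMeasurable J (volume.restrict (Ioo (0 : ℝ) 1)) :=
    (aemeasurable_restrict_iff_comap_subtype measurableSet_Ioo).2 hJ.aemeasurable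
  have h2 : AEMeasurable g (volume.restrict (Ioo (0 : ℝ) 1)) :=
    (aemeasurable_indicator_iff measurableSet_Ioo).1 hg.measurable_indicator.aemeasurable
  exact (h1.mul h2).aestronglyMeasurable

theorem integrableOn_mul (hM : 0 < M) (hb₁ : 0 < b₁) (hb₂ : 0 < b₂) (hδ : 0 < δ)
    (hJ : Measurable fun t : Ioo (0 : ℝ) 1 => J t)
    (hbound : BoundednessCondition g J hg c M b₁ b₂ δ) :
    IntegrableOn (fun t => J t * g t) (Ioo (0 : ℝ) 1) := by
  obtain ⟨ε, γ, hadm⟩ := exists_admissibleExponents hb₁ hb₂ hδ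
  obtain ⟨A, -, h⟩ := exists_abs_mul_le hM hb₁ hb₂ hδ hbound hadm
  refine (((integrableOn_endpointWeight hadm.gamma_lt_one).const_mul 2).const_mul A).mono'
    (aestronglyMeasurable_mul hg hJ) ?_
  exact (ae_restrict_iff' measurableSet_Ioo).2 (Eventually.of_forall h)

theorem aestronglyMeasurable_indicator_mul_scoreFun (hg : IsClassG g) (n : ℕ) {q : ℝ → ℝ}
    (hq : AEMeasurable q (volume.restrict (Ioo (0 : ℝ) 1))) :
    AEStronglyMeasurable (fun u => (Ioo (0 : ℝ) 1).indicator g (q u) * scoreFun c n u)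
      (volume.restrict (Ioo (0 : ℝ) 1)) :=
  ((hg.measurable_indicator.comp_aemeasurable hq).mul
    (measurable_scoreFun c n).aemeasurable).aestronglyMeasurable

/-- For a single `n`, the integrand is integrable as soon as the endpoint weight of `q` is. -/
theorem integrableOn_indicator_mul_scoreFun (hM : 0 < M) (hb₁ : 0 < b₁) (hb₂ : 0 < b₂)
    (hδ : 0 < δ) (hbound : BoundednessCondition g J hg c M b₁ b₂ δ)
    (hadm : AdmissibleExponents b₁ b₂ δ ε γ) {n : ℕ} (hn : 1 ≤ n) {q : ℝ → ℝ}
    (hq : AEMeasurable q (volume.restrict (Ioo (0 : ℝ) 1)))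
    (hint : IntegrableOn (fun u => (Ioo (0 : ℝ) 1).indicator (endpointWeight γ) (q u))
      (Ioo (0 : ℝ) 1)) :
    IntegrableOn (fun u => (Ioo (0 : ℝ) 1).indicator g (q u) * scoreFun c n u)
      (Ioo (0 : ℝ) 1) := by
  have hn1 : (1 : ℝ) ≤ n := by exact_mod_cast hn
  -- For fixed `n` the comparisons are free: the midpoint is at least `1 / (2n)` from both ends, so
  -- `C = 2n` makes the right-hand sides at least `1`. The constant `A` then depends on `n`, which
  -- is harmless for integrability.
  obtain ⟨A, -, h⟩ := exists_abs_indicator_mul_scoreFun_le hM hb₁ hb₂ hδ hbound hadm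
    (show (1 : ℝ) ≤ 2 * n by linarith)
  have key : ∀ v ∈ Ioo (0 : ℝ) 1, 1 ≤ n * (2 * v) → 1 ≤ 2 * n * v ^ (1 - ε) := by
    intro v hv hnv
    have := Real.rpow_le_rpow_of_exponent_ge hv.1 hv.2.le
      (show 1 - ε ≤ 1 by linarith [hadm.eps_pos])
    rw [Real.rpow_one] at this
    nlinarith
  refine ((hint.add ((integrableOn_endpointWeight hadm.gamma_lt_one).const_mul 2)).const_mul
    A).mono' (aestronglyMeasurable_indicator_mul_scoreFun hg n hq) ?_
  refine (ae_restrict_iff' measurableSet_Ioo).2 (Eventually.of_forall fun u hu => ?_)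
  have h0 : (0 : ℝ) < n := by linarith
  have hv := blockMid_mem_Ioo hn hu
  refine h n hn u hu (q u) fun hqu => ⟨hqu.2.le.trans (key _ hv ?_),
    (one_sub_mem_Ioo hqu).2.le.trans (key _ (one_sub_mem_Ioo hv) ?_)⟩
  · have h1 : (1 : ℝ) ≤ ⌈(n : ℝ) * u⌉₊ := by exact_mod_cast one_le_ceil hn hu
    have := ceil_div_le_blockMid hn hu
    rw [div_le_iff₀ h0] at this
    linarith
  · have h1 : (⌈(n : ℝ) * u⌉₊ : ℝ) ≤ n := by exact_mod_cast ceil_le hu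
    have := sub_ceil_div_le_blockMid hn hu
    rw [div_le_iff₀ h0] at this
    linarith

/-- Convergence of `∫ g(q_n(u)) J_n(u) du` for quantile functions `q_n` that tend to the identity
and are controlled near the endpoints. -/
theorem tendsto_integral_indicator_mul_scoreFun (hM : 0 < M) (hb₁ : 0 < b₁) (hb₂ : 0 < b₂)
    (hδ : 0 < δ) (hJ : Measurable fun t : Ioo (0 : ℝ) 1 => J t)
    (hbound : BoundednessCondition g J hg c M b₁ b₂ δ) (hsmooth : SmoothnessCondition g J hg c)
    (hadm : AdmissibleExponents b₁ b₂ δ ε γ) {q : ℕ → ℝ → ℝ} {C γ' C' : ℝ}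
    (hq : ∀ n, AEMeasurable (q n) (volume.restrict (Ioo (0 : ℝ) 1)))
    (hlim : ∀ u ∈ Ioo (0 : ℝ) 1, Tendsto (fun n => q n u) atTop (𝓝 u))
    (hC : 1 ≤ C)
    (hle : ∀ᶠ n in atTop, ∀ u ∈ Ioo (0 : ℝ) 1, q n u ∈ Ioo (0 : ℝ) 1 →
      q n u ≤ C * blockMid n u ^ (1 - ε) ∧ 1 - q n u ≤ C * (1 - blockMid n u) ^ (1 - ε))
    (hγγ' : γ < γ') (hγ'1 : γ' < 1)
    (hint : ∀ᶠ n in atTop, IntegrableOn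
      (fun u => (Ioo (0 : ℝ) 1).indicator (endpointWeight γ') (q n u)) (Ioo (0 : ℝ) 1))
    (hint_le : ∀ᶠ n in atTop,
      ∫ u in Ioo (0 : ℝ) 1, (Ioo (0 : ℝ) 1).indicator (endpointWeight γ') (q n u) ≤ C') :
    Tendsto (fun n => ∫ u in Ioo (0 : ℝ) 1, (Ioo (0 : ℝ) 1).indicator g (q n u) * scoreFun c n u)
      atTop (𝓝 (∫ t in Ioo (0 : ℝ) 1, J t * g t)) := by
  obtain ⟨A, hA, hA'⟩ := exists_abs_indicator_mul_scoreFun_le hM hb₁ hb₂ hδ hbound hadm hC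
  obtain ⟨A₀, hA₀, hA₀'⟩ := exists_abs_mul_le hM hb₁ hb₂ hδ hbound hadm
  have hw0 : ∀ x : ℝ, 0 ≤ (Ioo (0 : ℝ) 1).indicator (endpointWeight γ') x := fun x =>
    indicator_nonneg (fun t ht => endpointWeight_nonneg γ' ht) x
  have hW := integrableOn_endpointWeight hγ'1
  have hW0 : ∀ᵐ u ∂volume.restrict (Ioo (0 : ℝ) 1), 0 ≤ endpointWeight γ' u :=
    (ae_restrict_iff' measurableSet_Ioo).2
      (Eventually.of_forall fun u hu => endpointWeight_nonneg γ' hu)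
  set I := ∫ u in Ioo (0 : ℝ) 1, endpointWeight γ' u with hI
  have hI0 : 0 ≤ I := integral_nonneg_of_ae hW0
  refine tendsto_integral_of_abs_le_add_mul (C := |C'| + 2 * I)
    (G := fun n u => (Ioo (0 : ℝ) 1).indicator (endpointWeight γ') (q n u)
      + 2 * endpointWeight γ' u)
    (G₀ := fun u => 2 * endpointWeight γ' u)
    (fun n => aestronglyMeasurable_indicator_mul_scoreFun hg n (hq n))
    (aestronglyMeasurable_mul hg hJ) ?_ ?_ ?_ (hW.const_mul 2) ?_ ?_ ?_ ?_
  · filter_upwards [hint] with n hn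
    exact hn.add (hW.const_mul 2)
  · intro n
    filter_upwards [hW0] with u hu
    exact add_nonneg (hw0 _) (by positivity)
  · filter_upwards [hint, hint_le] with n h1 h2
    rw [integral_add h1 (hW.const_mul 2), integral_const_mul]
    linarith [le_abs_self C']
  · filter_upwards [hW0] with u hu
    positivity
  · rw [integral_const_mul]
    linarith [abs_nonneg C']
  · intro η hη
    -- The cut-off `β` makes the coefficient of the heavier weight at most `η`.
    obtain ⟨β, hβ0, hβ⟩ : ∃ β : ℝ, 0 < β ∧ (A + A₀) * β ^ (γ' - γ) ≤ η := by
      refine ⟨(η / (A + A₀ + 1)) ^ (1 / (γ' - γ)), by positivity, ?_⟩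
      rw [← Real.rpow_mul (by positivity), one_div_mul_cancel (by linarith), Real.rpow_one,
        mul_div_assoc', div_le_iff₀ (by positivity)]
      nlinarith
    have hβw : ∀ x ∈ Ioo (0 : ℝ) 1, endpointWeight γ x ≤
        2 * β ^ (-γ) + β ^ (γ' - γ) * endpointWeight γ' x := fun x hx =>
      endpointWeight_le_add hadm.gamma_pos.le hγγ'.le hβ0 hx
    have hp : 0 ≤ β ^ (-γ) := by positivity
    have hp' : 0 ≤ β ^ (γ' - γ) := by positivity
    have hβi : ∀ x, (Ioo (0 : ℝ) 1).indicator (endpointWeight γ) x ≤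
        2 * β ^ (-γ) + β ^ (γ' - γ) * (Ioo (0 : ℝ) 1).indicator (endpointWeight γ') x := by
      intro x
      by_cases hx : x ∈ Ioo (0 : ℝ) 1
      · rw [indicator_of_mem hx, indicator_of_mem hx]
        exact hβw x hx
      · rw [indicator_of_notMem hx, indicator_of_notMem hx]
        simpa using hp
    -- `6 = 2 + 2 * 2`: the weight at `q n u` occurs once and the weight at `u` twice.
    refine ⟨(A + A₀) * (6 * β ^ (-γ)), by positivity, ?_, ?_⟩
    · filter_upwards [hle, eventually_ge_atTop 1] with n h1 hn
      refine (ae_restrict_iff' measurableSet_Ioo).2 (Eventually.of_forall fun u hu => ?_)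
      have hw := endpointWeight_nonneg γ' hu
      calc |(Ioo (0 : ℝ) 1).indicator g (q n u) * scoreFun c n u|
          ≤ A * ((Ioo (0 : ℝ) 1).indicator (endpointWeight γ) (q n u)
            + 2 * endpointWeight γ u) := hA' n hn u hu (q n u) (h1 u hu)
        _ ≤ A * (6 * β ^ (-γ) + β ^ (γ' - γ) *
            ((Ioo (0 : ℝ) 1).indicator (endpointWeight γ') (q n u) + 2 * endpointWeight γ' u)) := by
            refine mul_le_mul_of_nonneg_left ?_ hA
            linarith [hβw u hu, hβi (q n u)]
        _ ≤ (A + A₀) * (6 * β ^ (-γ) + β ^ (γ' - γ) *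
            ((Ioo (0 : ℝ) 1).indicator (endpointWeight γ') (q n u) + 2 * endpointWeight γ' u)) := by
            have := hw0 (q n u)
            gcongr
            linarith
        _ = (A + A₀) * (6 * β ^ (-γ)) + (A + A₀) * β ^ (γ' - γ) *
            ((Ioo (0 : ℝ) 1).indicator (endpointWeight γ') (q n u) + 2 * endpointWeight γ' u) := by
            ring
        _ ≤ _ := by
            have := hw0 (q n u)
            gcongr
    · refine (ae_restrict_iff' measurableSet_Ioo).2 (Eventually.of_forall fun u hu => ?_)
      have hw := endpointWeight_nonneg γ' hu
      calc |J u * g u| ≤ A₀ * (2 * endpointWeight γ u) := hA₀' u hu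
        _ ≤ A₀ * (6 * β ^ (-γ) + β ^ (γ' - γ) * (2 * endpointWeight γ' u)) := by
            gcongr
            linarith [hβw u hu]
        _ ≤ (A + A₀) * (6 * β ^ (-γ) + β ^ (γ' - γ) * (2 * endpointWeight γ' u)) := by
            gcongr
            linarith
        _ = (A + A₀) * (6 * β ^ (-γ)) + (A + A₀) * β ^ (γ' - γ) * (2 * endpointWeight γ' u) := by
            ring
        _ ≤ _ := by gcongr
  · filter_upwards [hg.ae_continuousAt, hsmooth.ae_volume, ae_restrict_mem measurableSet_Ioo]
      with u hcont hJn hu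
    have h1 : Tendsto (fun n => (Ioo (0 : ℝ) 1).indicator g (q n u)) atTop (𝓝 (g u)) := by
      refine (hcont.tendsto.comp (hlim u hu)).congr' ?_
      filter_upwards [(hlim u hu).eventually (Ioo_mem_nhds hu.1 hu.2)] with n hn
      exact (indicator_of_mem (s := Ioo (0 : ℝ) 1) hn g).symm
    -- At a zero of `g` the scores need not converge, but they are bounded by `B(u)` while `g (q n
    -- u) → 0`.
    by_cases hgu : g u = 0
    · rw [hgu, mul_zero]
      rw [hgu] at h1
      refine squeeze_zero_norm' (a := fun n =>
        |(Ioo (0 : ℝ) 1).indicator g (q n u)| * boundB M b₁ b₂ u) ?_ ?_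
      · filter_upwards [eventually_ge_atTop 1] with n hn
        rw [Real.norm_eq_abs, abs_mul]
        gcongr
        exact hbound.abs_score_le n hn u hu
      · simpa using h1.abs.mul_const (boundB M b₁ b₂ u)
    · rw [mul_comm]
      exact h1.mul (hJn hgu)

end Convergence

/-! ### Almost sure bounds for uniform samples -/

section UniformSample

variable {Ω : Type*} [MeasurableSpace Ω] {P : Measure Ω}

theorem map_eq_restrict_of_isUniform {X : Ω → ℝ}
    (hX : pdf.IsUniform X (Ioo (0 : ℝ) 1) P volume) :
    P.map X = volume.restrict (Ioo (0 : ℝ) 1) := by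
  rw [hX, ProbabilityTheory.cond]
  simp

theorem ae_eventually_notMem_of_le [IsFiniteMeasure P] {s : ℕ → Set Ω} {f : ℕ → ℝ}
    (hf : Summable f) (h : ∀ᶠ n in atTop, P.real (s n) ≤ f n) :
    ∀ᵐ ω ∂P, ∀ᶠ n in atTop, ω ∉ s n := by
  obtain ⟨N, hN⟩ := eventually_atTop.1 h
  have hsum : Summable fun n => P.real (s (n + N)) :=
    Summable.of_nonneg_of_le (fun n => measureReal_nonneg) (fun n => hN _ (by omega))
      ((summable_nat_add_iff N).2 hf)
  have h1 : ∑' n, P (s (n + N)) ≠ ∞ := by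
    have h2 : ∀ n, P (s (n + N)) = ENNReal.ofReal (P.real (s (n + N))) := fun n => by
      rw [ofReal_measureReal]
    simp_rw [h2]
    exact hsum.tsum_ofReal_ne_top
  filter_upwards [ae_eventually_notMem h1] with ω hω
  filter_upwards [(tendsto_sub_atTop_nat N).eventually hω, eventually_ge_atTop N] with n h2 h3
  rwa [Nat.sub_add_cancel h3] at h2

theorem summable_mul_exp_neg_mul_rpow {a ρ : ℝ} (ha : 0 < a) (hρ : 0 < ρ) :
    Summable fun n : ℕ => (n : ℝ) * Real.exp (-a * (n : ℝ) ^ ρ) := by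
  have h1 : Tendsto (fun n : ℕ => (n : ℝ) ^ ρ) atTop atTop :=
    (tendsto_rpow_atTop hρ).comp tendsto_natCast_atTop_atTop
  -- With this exponent `(n^ρ)^(-3/ρ) = n^(-3)`, which leaves `n^(-2)` after multiplication by `n`.
  have h2 := (isLittleO_exp_neg_mul_rpow_atTop ha (-3 / ρ)).comp_tendsto h1
  have h3 : Summable fun n : ℕ => (n : ℝ) ^ (-2 : ℝ) := Real.summable_nat_rpow.2 (by norm_num)
  refine summable_of_isBigO_nat h3 ?_
  have h4 := (Asymptotics.isBigO_refl (fun n : ℕ => (n : ℝ)) atTop).mul h2.isBigO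
  refine h4.congr' EventuallyEq.rfl ?_
  filter_upwards [eventually_gt_atTop 0] with n hn
  have hn0 : (0 : ℝ) < n := by exact_mod_cast hn
  simp only [Function.comp]
  rw [← Real.rpow_mul hn0.le, mul_div_cancel₀ _ hρ.ne']
  nth_rewrite 1 [← Real.rpow_one (n : ℝ)]
  rw [← Real.rpow_add hn0]
  norm_num

variable {ξ : ℕ → Ω → ℝ}

theorem integral_comp_of_isUniform {X : Ω → ℝ} (hXm : Measurable X)
    (hX : pdf.IsUniform X (Ioo (0 : ℝ) 1) P volume) {ψ : ℝ → ℝ} (hψ : Measurable ψ) :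
    ∫ ω, ψ (X ω) ∂P = ∫ t in Ioo (0 : ℝ) 1, ψ t := by
  rw [← map_eq_restrict_of_isUniform hX, integral_map hXm.aemeasurable hψ.aestronglyMeasurable]

theorem ae_forall_mem_Ioo (hξ_meas : ∀ i, Measurable (ξ i))
    (hξ_unif : ∀ i, pdf.IsUniform (ξ i) (Ioo (0 : ℝ) 1) P volume) :
    ∀ᵐ ω ∂P, ∀ i, ξ i ω ∈ Ioo (0 : ℝ) 1 := by
  rw [ae_all_iff]
  intro i
  have : ∀ᵐ t ∂P.map (ξ i), t ∈ Ioo (0 : ℝ) 1 := by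
    rw [map_eq_restrict_of_isUniform (hξ_unif i)]
    exact ae_restrict_mem measurableSet_Ioo
  exact ae_of_ae_map (hξ_meas i).aemeasurable this

theorem ae_tendsto_sum_comp_div (hξ_meas : ∀ i, Measurable (ξ i)) (hξ_indep : iIndepFun ξ P)
    (hξ_unif : ∀ i, pdf.IsUniform (ξ i) (Ioo (0 : ℝ) 1) P volume) {ψ : ℝ → ℝ}
    (hψ : Measurable ψ) (hψi : IntegrableOn ψ (Ioo (0 : ℝ) 1)) :
    ∀ᵐ ω ∂P, Tendsto (fun n : ℕ => (∑ i ∈ Finset.range n, ψ (ξ i ω)) / n) atTop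
      (𝓝 (∫ t in Ioo (0 : ℝ) 1, ψ t)) := by
  rw [← integral_comp_of_isUniform (hξ_meas 0) (hξ_unif 0) hψ]
  refine strong_law_ae_real (fun i ω => ψ (ξ i ω)) ?_ ?_ ?_
  · have h : Integrable ψ (P.map (ξ 0)) := by
      rw [map_eq_restrict_of_isUniform (hξ_unif 0)]
      exact hψi
    exact h.comp_measurable (hξ_meas 0)
  · intro i j hij
    exact (hξ_indep.indepFun hij).comp hψ hψ
  · intro i
    have : IdentDistrib (ξ i) (ξ 0) P P := ⟨(hξ_meas i).aemeasurable, (hξ_meas 0).aemeasurable, by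
      rw [map_eq_restrict_of_isUniform (hξ_unif i), map_eq_restrict_of_isUniform (hξ_unif 0)]⟩
    exact this.comp hψ

variable [IsProbabilityMeasure P]

/-- Exponential Markov inequality for sums of functions of a uniform sample. -/
theorem measureReal_le_sum_comp_le (hξ_meas : ∀ i, Measurable (ξ i)) (hξ_indep : iIndepFun ξ P)
    (hξ_unif : ∀ i, pdf.IsUniform (ξ i) (Ioo (0 : ℝ) 1) P volume) {ψ : ℝ → ℝ}
    (hψ : Measurable ψ) {K : ℝ} (hK : ∀ t, ψ t ≤ K) (n : ℕ) (a : ℝ) :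
    P.real {ω | a ≤ ∑ i ∈ Finset.range n, ψ (ξ i ω)} ≤
      Real.exp (-a) * (∫ t in Ioo (0 : ℝ) 1, Real.exp (ψ t)) ^ n := by
  have hm : ∀ i, Measurable fun ω => ψ (ξ i ω) := fun i => hψ.comp (hξ_meas i)
  have hind : iIndepFun (fun i ω => ψ (ξ i ω)) P := hξ_indep.comp (fun _ => ψ) fun _ => hψ
  have hint : Integrable
      (fun ω => Real.exp (1 * (∑ i ∈ Finset.range n, fun ω => ψ (ξ i ω)) ω)) P := by
    refine (integrable_const (Real.exp (n * K))).mono' ?_ ?_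
    · have : Measurable (∑ i ∈ Finset.range n, fun ω => ψ (ξ i ω)) := by fun_prop
      exact (Real.measurable_exp.comp (this.const_mul 1)).aestronglyMeasurable
    · refine Eventually.of_forall fun ω => ?_
      rw [Real.norm_eq_abs, Real.abs_exp, one_mul, Finset.sum_apply]
      refine Real.exp_le_exp.2 ((Finset.sum_le_card_nsmul _ _ K fun i _ => hK _).trans ?_)
      simp
  have h := measure_ge_le_exp_mul_mgf (μ := P) a zero_le_one hint
  rw [hind.mgf_sum hm] at h
  have hmgf : ∀ i, mgf (fun ω => ψ (ξ i ω)) P 1 = ∫ t in Ioo (0 : ℝ) 1, Real.exp (ψ t) := by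
    intro i
    have := integral_comp_of_isUniform (hξ_meas i) (hξ_unif i) (Real.measurable_exp.comp hψ)
    simpa [mgf] using this
  simp only [hmgf, Finset.prod_const, Finset.card_range, neg_mul, one_mul, Finset.sum_apply] at h
  exact h

/-- A strong law with a varying summand `φ n` of size `O(n ^ ρ)`, `ρ < 1`: the averages stay
bounded. -/
theorem ae_eventually_sum_comp_le (hξ_meas : ∀ i, Measurable (ξ i)) (hξ_indep : iIndepFun ξ P)
    (hξ_unif : ∀ i, pdf.IsUniform (ξ i) (Ioo (0 : ℝ) 1) P volume) {φ : ℕ → ℝ → ℝ}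
    (hφ : ∀ n, Measurable (φ n)) {L ρ A : ℝ} (hL : 0 < L) (hρ : ρ < 1) (hA : 0 < A)
    (hφ0 : ∀ n, 1 ≤ n → ∀ t, 0 ≤ φ n t) (hφL : ∀ᶠ n : ℕ in atTop, ∀ t, φ n t ≤ L * (n : ℝ) ^ ρ)
    (hφA : ∀ n, 1 ≤ n → ∫ t in Ioo (0 : ℝ) 1, φ n t ≤ A) :
    ∀ᵐ ω ∂P, ∀ᶠ n : ℕ in atTop, ∑ i ∈ Finset.range n, φ n (ξ i ω) ≤ 3 * A * n := by
  have hsum := summable_mul_exp_neg_mul_rpow (div_pos hA hL) (sub_pos.2 hρ)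
  have h1 : ∀ᶠ n : ℕ in atTop, P.real {ω | 3 * A * n ≤ ∑ i ∈ Finset.range n, φ n (ξ i ω)} ≤
      (n : ℝ) * Real.exp (-(A / L) * (n : ℝ) ^ (1 - ρ)) := by
    filter_upwards [hφL, eventually_ge_atTop 1] with n hn hn1
    have hn0 : (0 : ℝ) < n := by exact_mod_cast hn1
    -- Dividing by the supremum bound `R` makes the summands at most `1`. The exponential Markov
    -- inequality then gives `exp (-3An/R + 2An/R) = exp (-An/R)`, and `n/R` is of order `n^(1-ρ)`.
    set R : ℝ := L * (n : ℝ) ^ ρ with hR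
    have hR0 : 0 < R := by positivity
    have hnR : n / R = (n : ℝ) ^ (1 - ρ) / L := by
      rw [hR, Real.rpow_sub hn0, Real.rpow_one]
      field_simp
    have hψ1 : ∀ t, φ n t / R ≤ 1 := fun t => (div_le_one hR0).2 (hn t)
    have h2 := measureReal_le_sum_comp_le hξ_meas hξ_indep hξ_unif ((hφ n).div_const R)
      hψ1 n (3 * A * n / R)
    have hset : {ω | 3 * A * n / R ≤ ∑ i ∈ Finset.range n, φ n (ξ i ω) / R} =
        {ω | 3 * A * n ≤ ∑ i ∈ Finset.range n, φ n (ξ i ω)} := by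
      ext ω
      simp only [mem_ofPred_eq]
      rw [← Finset.sum_div, div_le_div_iff_of_pos_right hR0]
    rw [hset] at h2
    refine h2.trans ?_
    have hint1 : Integrable (φ n) (volume.restrict (Ioo (0 : ℝ) 1)) := by
      refine (integrable_const R).mono' (hφ n).aestronglyMeasurable (Eventually.of_forall fun t => ?_)
      rw [Real.norm_eq_abs, abs_of_nonneg (hφ0 n hn1 t)]
      exact hn t
    -- On `[0, 1]`, `exp x ≤ 1 + x + x² ≤ 1 + 2x`.
    have hexp : ∀ t, Real.exp (φ n t / R) ≤ 1 + 2 / R * φ n t := by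
      intro t
      have h0 : 0 ≤ φ n t / R := div_nonneg (hφ0 n hn1 t) hR0.le
      have h3 := Real.abs_exp_sub_one_sub_id_le (x := φ n t / R)
        (by rw [abs_of_nonneg h0]; exact hψ1 t)
      rw [abs_le] at h3
      have h4 : 2 / R * φ n t = 2 * (φ n t / R) := by ring
      nlinarith [h3.2, hψ1 t]
    have hI : ∫ t in Ioo (0 : ℝ) 1, Real.exp (φ n t / R) ≤ Real.exp (2 * A / R) := by
      calc ∫ t in Ioo (0 : ℝ) 1, Real.exp (φ n t / R)
          ≤ ∫ t in Ioo (0 : ℝ) 1, (1 + 2 / R * φ n t) := by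
            refine integral_mono_of_nonneg (Eventually.of_forall fun t => (Real.exp_pos _).le)
              ((integrable_const 1).add (hint1.const_mul _)) (Eventually.of_forall hexp)
        _ = 1 + 2 / R * ∫ t in Ioo (0 : ℝ) 1, φ n t := by
            rw [integral_add (integrable_const 1) (hint1.const_mul _), integral_const_mul]
            simp
        _ ≤ 1 + 2 / R * A := by
            have := hφA n hn1
            gcongr
        _ ≤ Real.exp (2 * A / R) := by
            have := Real.add_one_le_exp (2 * A / R)
            have h5 : 2 / R * A = 2 * A / R := by ring
            linarith
    calc Real.exp (-(3 * A * n / R)) * (∫ t in Ioo (0 : ℝ) 1, Real.exp (φ n t / R)) ^ n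
        ≤ Real.exp (-(3 * A * n / R)) * Real.exp (2 * A / R) ^ n := by
          have : 0 ≤ ∫ t in Ioo (0 : ℝ) 1, Real.exp (φ n t / R) :=
            integral_nonneg fun t => (Real.exp_pos _).le
          gcongr
      _ = Real.exp (-A * (n / R)) := by
          rw [← Real.exp_nat_mul, ← Real.exp_add]
          congr 1
          ring
      _ = Real.exp (-(A / L) * (n : ℝ) ^ (1 - ρ)) := by
          rw [hnR]
          congr 1
          ring
      _ ≤ _ := le_mul_of_one_le_left (Real.exp_pos _).le (by exact_mod_cast hn1)
  filter_upwards [ae_eventually_notMem_of_le hsum h1] with ω hω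
  filter_upwards [hω] with n hn
  simp only [not_le] at hn
  exact hn.le

/-- Chernoff bound for the lower tail of a binomial count: `E exp(-1_S) = 1 - (1 - e⁻¹) t ≤
exp(-3t/5)`, and `1/2 - 3/5 = -1/10`. -/
theorem measureReal_sum_indicator_le (hξ_meas : ∀ i, Measurable (ξ i)) (hξ_indep : iIndepFun ξ P)
    (hξ_unif : ∀ i, pdf.IsUniform (ξ i) (Ioo (0 : ℝ) 1) P volume) {S : Set ℝ}
    (hS : MeasurableSet S) {t : ℝ} (ht : (volume.restrict (Ioo (0 : ℝ) 1)).real S = t) (n : ℕ) :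
    P.real {ω | ∑ i ∈ Finset.range n, S.indicator (fun _ => (1 : ℝ)) (ξ i ω) ≤ n * t / 2} ≤
      Real.exp (-(1 / 10) * (n * t)) := by
  have ht0 : 0 ≤ t := ht ▸ measureReal_nonneg
  have h1 := measureReal_le_sum_comp_le hξ_meas hξ_indep hξ_unif
    (ψ := fun x => -S.indicator (fun _ => (1 : ℝ)) x) (measurable_const.indicator hS).neg (K := 0)
    (fun x => neg_nonpos.2 (indicator_nonneg (fun _ _ => zero_le_one) x)) n (-(n * t / 2))
  have hset : {ω | -(n * t / 2) ≤ ∑ i ∈ Finset.range n, -S.indicator (fun _ => (1 : ℝ)) (ξ i ω)} =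
      {ω | ∑ i ∈ Finset.range n, S.indicator (fun _ => (1 : ℝ)) (ξ i ω) ≤ n * t / 2} := by
    ext ω
    simp only [mem_ofPred_eq, Finset.sum_neg_distrib, neg_le_neg_iff]
  rw [hset] at h1
  refine h1.trans ?_
  have he : Real.exp (-1) ≤ 2 / 5 := by
    have := Real.exp_neg_one_lt_d9
    linarith
  have hfun : ∀ x, Real.exp (-S.indicator (fun _ => (1 : ℝ)) x) =
      1 - (1 - Real.exp (-1)) * S.indicator (fun _ => (1 : ℝ)) x := by
    intro x
    by_cases hx : x ∈ S <;> simp [hx]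
  have hi : Integrable (S.indicator fun _ => (1 : ℝ)) (volume.restrict (Ioo (0 : ℝ) 1)) :=
    (integrable_const 1).indicator hS
  have hI : ∫ x in Ioo (0 : ℝ) 1, Real.exp (-S.indicator (fun _ => (1 : ℝ)) x) ≤
      Real.exp (-(3 / 5) * t) := by
    simp_rw [hfun]
    rw [integral_sub (integrable_const 1) (hi.const_mul _), integral_const_mul,
      integral_indicator_const _ hS, ht]
    simp only [integral_const, measureReal_restrict_apply MeasurableSet.univ, univ_inter,
      Real.volume_real_Ioo, smul_eq_mul]
    have := Real.add_one_le_exp (-(3 / 5) * t)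
    rw [sub_zero, max_eq_left zero_le_one, one_mul, mul_one]
    nlinarith
  calc Real.exp (- -(n * t / 2)) *
        (∫ x in Ioo (0 : ℝ) 1, Real.exp (-S.indicator (fun _ => (1 : ℝ)) x)) ^ n
      ≤ Real.exp (- -(n * t / 2)) * Real.exp (-(3 / 5) * t) ^ n := by
        have : 0 ≤ ∫ x in Ioo (0 : ℝ) 1, Real.exp (-S.indicator (fun _ => (1 : ℝ)) x) :=
          integral_nonneg fun t => (Real.exp_pos _).le
        gcongr
    _ = Real.exp (-(1 / 10) * (n * t)) := by
        rw [← Real.exp_nat_mul, ← Real.exp_add]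
        congr 1
        ring

/-- Almost surely, for all large `n` and all `j ≤ n`, at least `j` of the first `n` sample points
lie in the sets `S t` of uniform probability `t = 2 (j / n) ^ (1 - ε)`. -/
theorem ae_eventually_le_sum_indicator (hξ_meas : ∀ i, Measurable (ξ i))
    (hξ_indep : iIndepFun ξ P)
    (hξ_unif : ∀ i, pdf.IsUniform (ξ i) (Ioo (0 : ℝ) 1) P volume) {S : ℝ → Set ℝ}
    (hS : ∀ t, MeasurableSet (S t))
    (hSt : ∀ t ∈ Ioo (0 : ℝ) 1, (volume.restrict (Ioo (0 : ℝ) 1)).real (S t) = t)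
    {ε : ℝ} (hε0 : 0 < ε) (hε1 : ε < 1) :
    ∀ᵐ ω ∂P, ∀ᶠ n : ℕ in atTop, ∀ j : ℕ, 1 ≤ j → j ≤ n → 2 * ((j : ℝ) / n) ^ (1 - ε) < 1 →
      (j : ℝ) ≤ ∑ i ∈ Finset.range n,
        (S (2 * ((j : ℝ) / n) ^ (1 - ε))).indicator (fun _ => (1 : ℝ)) (ξ i ω) := by
  set τ : ℕ → ℕ → ℝ := fun n j => 2 * ((j : ℝ) / n) ^ (1 - ε) with hτ
  -- Fewer than half of the expected number `n τ` of points lie in `S τ`, or exactly half.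
  set bad : ℕ → ℕ → Set Ω := fun n j => if τ n j < 1 then
    {ω | ∑ i ∈ Finset.range n, (S (τ n j)).indicator (fun _ => (1 : ℝ)) (ξ i ω) ≤ n * τ n j / 2}
    else ∅ with hbad
  have hprob : ∀ n : ℕ, P.real (⋃ j ∈ Finset.Icc 1 n, bad n j) ≤
      (n : ℝ) * Real.exp (-(1 / 5) * (n : ℝ) ^ ε) := by
    intro n
    refine (measureReal_biUnion_finset_le _ _).trans ?_
    have : ∀ j ∈ Finset.Icc 1 n, P.real (bad n j) ≤ Real.exp (-(1 / 5) * (n : ℝ) ^ ε) := by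
      intro j hj
      obtain ⟨hj1, hjn⟩ := Finset.mem_Icc.1 hj
      have hj1' : (1 : ℝ) ≤ j := by exact_mod_cast hj1
      have hn0 : (0 : ℝ) < n := by exact_mod_cast hj1.trans hjn
      simp only [hbad]
      split_ifs with h
      · have hτ0 : 0 < τ n j := by simp only [hτ]; positivity
        refine (measureReal_sum_indicator_le hξ_meas hξ_indep hξ_unif (hS _)
          (hSt _ ⟨hτ0, h⟩) n).trans (Real.exp_le_exp.2 ?_)
        -- The worst case is `j = 1`; the union over `j ≤ n` then only costs a factor `n`.
        have h1 : (n : ℝ) ^ ε ≤ n * ((j : ℝ) / n) ^ (1 - ε) := by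
          calc (n : ℝ) ^ ε = n * (1 / n : ℝ) ^ (1 - ε) := by
                rw [one_div, Real.inv_rpow hn0.le, ← Real.rpow_neg hn0.le]
                nth_rewrite 2 [← Real.rpow_one (n : ℝ)]
                rw [← Real.rpow_add hn0]
                congr 1
                ring
            _ ≤ _ := by
                gcongr
        simp only [hτ]
        nlinarith
      · simpa using (Real.exp_pos _).le
    refine (Finset.sum_le_card_nsmul _ _ _ this).trans ?_
    simp
  filter_upwards [ae_eventually_notMem_of_le
    (summable_mul_exp_neg_mul_rpow (a := 1 / 5) (by norm_num) hε0)
    (Eventually.of_forall hprob)] with ω hω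
  filter_upwards [hω] with n hn j hj1 hjn hlt
  have hmem : ω ∉ bad n j := fun hmem =>
    hn (mem_biUnion (Finset.mem_coe.2 (Finset.mem_Icc.2 ⟨hj1, hjn⟩)) hmem)
  have hlt' : τ n j < 1 := hlt
  simp only [hbad, if_pos hlt', mem_ofPred_eq, not_le] at hmem
  refine le_trans ?_ hmem.le
  have hn0 : (0 : ℝ) < n := by exact_mod_cast hj1.trans hjn
  have hj0 : (0 : ℝ) < j := by exact_mod_cast hj1
  have hjn' : (j : ℝ) / n ≤ 1 := by
    rw [div_le_one hn0]
    exact_mod_cast hjn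
  -- `j / n ≤ (j / n)^(1-ε)`, so half of the expected count is at least `j`.
  have h1 := Real.rpow_le_rpow_of_exponent_ge (div_pos hj0 hn0) hjn'
    (show 1 - ε ≤ 1 by linarith)
  rw [Real.rpow_one, div_le_iff₀ hn0] at h1
  simp only [hτ]
  linarith

theorem volume_restrict_real_Iic {t : ℝ} (ht : t ∈ Icc (0 : ℝ) 1) :
    (volume.restrict (Ioo (0 : ℝ) 1)).real (Iic t) = t := by
  rw [measureReal_restrict_apply measurableSet_Iic]
  rcases ht.2.eq_or_lt with rfl | h1
  · rw [inter_eq_self_of_subset_right (fun x hx => hx.2.le)]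
    simp
  · have : Iic t ∩ Ioo 0 1 = Ioc 0 t := by
      ext x
      simp only [mem_inter_iff, mem_Iic, mem_Ioo, mem_Ioc]
      constructor
      · rintro ⟨h1, h2, -⟩
        exact ⟨h2, h1⟩
      · rintro ⟨h2, h3⟩
        exact ⟨h3, h2, h3.trans_lt h1⟩
    rw [this, Real.volume_real_Ioc_of_le ht.1, sub_zero]

theorem volume_restrict_real_Ici {t : ℝ} (ht : t ∈ Ioo (0 : ℝ) 1) :
    (volume.restrict (Ioo (0 : ℝ) 1)).real (Ici (1 - t)) = t := by
  rw [measureReal_restrict_apply measurableSet_Ici]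
  have : Ici (1 - t) ∩ Ioo 0 1 = Ico (1 - t) 1 := by
    ext x
    simp only [mem_inter_iff, mem_Ici, mem_Ioo, mem_Ico]
    constructor
    · rintro ⟨h1, h2, h3⟩
      exact ⟨h1, h3⟩
    · rintro ⟨h2, h3⟩
      exact ⟨h2, by linarith [ht.2], h3⟩
  rw [this, Real.volume_real_Ico_of_le (by linarith [ht.1])]
  ring

end UniformSample

/-! ### Quantile functions -/

section Quantile

variable (ν : Measure ℝ)

/-- The Galois connection between a distribution function and its left-continuous inverse. -/
theorem leftInverse_cdf_le_iff {u : ℝ} (hu : u ∈ Ioo (0 : ℝ) 1) (t : ℝ) :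
    leftInverse (cdf ν) u ≤ t ↔ u ≤ cdf ν t := by
  set S : Set ℝ := {t | u ≤ cdf ν t} with hS
  have hne : S.Nonempty := by
    obtain ⟨t, ht⟩ := ((tendsto_cdf_atTop ν).eventually (lt_mem_nhds hu.2)).exists
    exact ⟨t, ht.le⟩
  have hbdd : BddBelow S := by
    obtain ⟨a, ha⟩ := ((tendsto_cdf_atBot ν).eventually (gt_mem_nhds hu.1)).exists
    refine ⟨a, fun t ht => ?_⟩
    by_contra! h
    exact absurd (ht.trans (monotone_cdf ν h.le)) (not_le.2 ha)
  -- Right continuity: the infimum is attained.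
  have hmem : u ≤ cdf ν (sInf S) := by
    have h1 : Tendsto (cdf ν) (𝓝[>] (sInf S)) (𝓝 (cdf ν (sInf S))) :=
      ((cdf ν).right_continuous (sInf S)).mono_left (nhdsWithin_mono _ Ioi_subset_Ici_self)
    refine ge_of_tendsto h1 ?_
    filter_upwards [self_mem_nhdsWithin] with s hs
    obtain ⟨t, ht, hts⟩ := (csInf_lt_iff hbdd hne).1 hs
    exact le_trans ht (monotone_cdf ν hts.le)
  exact ⟨fun h => hmem.trans (monotone_cdf ν h), fun h => csInf_le hbdd h⟩

theorem monotoneOn_leftInverse_cdf : MonotoneOn (leftInverse (cdf ν)) (Ioo 0 1) := by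
  intro u hu v hv huv
  rw [leftInverse_cdf_le_iff ν hu]
  exact huv.trans ((leftInverse_cdf_le_iff ν hv _).1 le_rfl)

theorem aemeasurable_leftInverse_cdf :
    AEMeasurable (leftInverse (cdf ν)) (volume.restrict (Ioo (0 : ℝ) 1)) :=
  aemeasurable_restrict_of_monotoneOn measurableSet_Ioo (monotoneOn_leftInverse_cdf ν)

/-- The quantile transform: by the Galois connection the preimage of `Iic t` is, within `(0, 1)`,
`Iic (F t)`. -/
theorem map_leftInverse_cdf [IsProbabilityMeasure ν] :
    (volume.restrict (Ioo (0 : ℝ) 1)).map (leftInverse (cdf ν)) = ν := by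
  refine Measure.ext_of_Iic _ _ fun t => ?_
  rw [Measure.map_apply_of_aemeasurable (aemeasurable_leftInverse_cdf ν) measurableSet_Iic]
  have h1 : (leftInverse (cdf ν) ⁻¹' Iic t : Set ℝ) =ᵐ[volume.restrict (Ioo (0 : ℝ) 1)]
      Iic (cdf ν t) := by
    refine (ae_restrict_iff' measurableSet_Ioo).2 (Eventually.of_forall fun u hu => ?_)
    exact propext (leftInverse_cdf_le_iff ν hu t)
  rw [measure_congr h1, ← ofReal_measureReal,
    volume_restrict_real_Iic ⟨cdf_nonneg ν t, cdf_le_one ν t⟩, ofReal_cdf]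

end Quantile

/-- Compare `F_n` with `u` at a point strictly between `u` and the candidate bound, and transfer the
inequality by the Galois connection. -/
theorem tendsto_leftInverse_cdf {ν : ℕ → Measure ℝ}
    (h : ∀ t ∈ Ioo (0 : ℝ) 1, Tendsto (fun n => cdf (ν n) t) atTop (𝓝 t)) {u : ℝ}
    (hu : u ∈ Ioo (0 : ℝ) 1) : Tendsto (fun n => leftInverse (cdf (ν n)) u) atTop (𝓝 u) := by
  refine tendsto_order.2 ⟨fun a ha => ?_, fun a ha => ?_⟩
  · obtain ⟨t, h1, h2⟩ := exists_between (max_lt ha hu.1)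
    have ht : t ∈ Ioo (0 : ℝ) 1 := ⟨(le_max_right _ _).trans_lt h1, h2.trans hu.2⟩
    filter_upwards [(h t ht).eventually (gt_mem_nhds h2)] with n hn
    refine ((le_max_left _ _).trans_lt h1).trans ?_
    by_contra! hle
    exact absurd ((leftInverse_cdf_le_iff _ hu _).1 hle) (not_le.2 hn)
  · obtain ⟨t, h1, h2⟩ := exists_between (lt_min ha hu.2)
    have ht : t ∈ Ioo (0 : ℝ) 1 := ⟨hu.1.trans h1, h2.trans_le (min_le_right _ _)⟩
    filter_upwards [(h t ht).eventually (lt_mem_nhds h1)] with n hn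
    exact ((leftInverse_cdf_le_iff _ hu _).2 hn.le).trans_lt (h2.trans_le (min_le_left _ _))

/-- Control of a quantile near an endpoint in terms of the position of the block midpoint. -/
theorem le_mul_rpow_of_forall_block {n : ℕ} (hn : 1 ≤ n) {ε κ Q w v : ℝ} (hε0 : 0 < ε)
    (hε1 : ε < 1) (hκ0 : 0 < κ) (hκ1 : κ ≤ 1) (hQ : Q < 1) (hw : 0 < w) (hv : w ≤ 2 * v)
    (hnv : 1 / (n : ℝ) ≤ 2 * v)
    (h : ∀ j : ℕ, 1 ≤ j → j ≤ n → 2 * ((j : ℝ) / n) ^ (1 - ε) < 1 → w < κ * ((j : ℝ) / n) →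
      Q ≤ 2 * ((j : ℝ) / n) ^ (1 - ε)) :
    Q ≤ 8 / κ * v ^ (1 - ε) := by
  have hn0 : (0 : ℝ) < n := by exact_mod_cast hn
  have hv0 : 0 < v := by linarith
  -- The least `j` with `w < κ j / n`. Rounding costs `1 / n`, which `2v` dominates as it does `w`;
  -- hence `j / n ≤ 4v / κ`.
  set j : ℕ := ⌊(n : ℝ) * w / κ⌋₊ + 1 with hj
  have hj1 : (n : ℝ) * w / κ < j := by
    rw [hj]
    push_cast
    exact Nat.lt_floor_add_one _
  have hj2 : (j : ℝ) ≤ n * w / κ + 1 := by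
    rw [hj]
    push_cast
    gcongr
    exact Nat.floor_le (by positivity)
  have hjn : (j : ℝ) / n ≤ 4 / κ * v := by
    rw [div_le_iff₀ hn0]
    have h1 : 1 ≤ 2 * v * n := by
      rwa [div_le_iff₀ hn0] at hnv
    have h2 : 1 ≤ 2 * v * n / κ := by
      rw [le_div_iff₀ hκ0]
      linarith
    have h3 : n * w / κ ≤ 2 * v * n / κ := by
      refine div_le_div_of_nonneg_right ?_ hκ0.le
      nlinarith
    calc (j : ℝ) ≤ n * w / κ + 1 := hj2
      _ ≤ 2 * v * n / κ + 2 * v * n / κ := add_le_add h3 h2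
      _ = 4 / κ * v * n := by ring
  have hQj : Q ≤ 2 * ((j : ℝ) / n) ^ (1 - ε) := by
    -- Otherwise the bound is at least `1 > Q`. In the main case `j ≤ n` is automatic.
    by_cases hlt : 2 * ((j : ℝ) / n) ^ (1 - ε) < 1
    · have hjn' : j ≤ n := by
        by_contra! hgt
        have h1 : (1 : ℝ) ≤ (j : ℝ) / n := by
          rw [le_div_iff₀ hn0, one_mul]
          exact_mod_cast hgt.le
        have := Real.one_le_rpow h1 (by linarith : 0 ≤ 1 - ε)
        linarith
      refine h j (by omega) hjn' hlt ?_
      rw [div_lt_iff₀ hκ0] at hj1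
      rw [← mul_div_assoc, lt_div_iff₀ hn0]
      linarith
    · linarith
  have hκ4 : 1 ≤ 4 / κ := by
    rw [le_div_iff₀ hκ0]
    linarith
  calc Q ≤ 2 * ((j : ℝ) / n) ^ (1 - ε) := hQj
    _ ≤ 2 * (4 / κ * v) ^ (1 - ε) := by
        gcongr
    _ = 2 * ((4 / κ) ^ (1 - ε) * v ^ (1 - ε)) := by
        rw [Real.mul_rpow (by positivity) hv0.le]
    _ ≤ 2 * (4 / κ * v ^ (1 - ε)) := by
        gcongr
        exact Real.rpow_le_self_of_one_le hκ4 (by linarith)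
    _ = 8 / κ * v ^ (1 - ε) := by ring

theorem one_div_le_two_mul_blockMid {n : ℕ} (hn : 1 ≤ n) {u : ℝ} (hu : u ∈ Ioo (0 : ℝ) 1) :
    1 / (n : ℝ) ≤ 2 * blockMid n u := by
  refine le_trans ?_ (ceil_div_le_blockMid hn hu)
  gcongr
  exact_mod_cast one_le_ceil hn hu

theorem one_div_le_two_mul_one_sub_blockMid {n : ℕ} (hn : 1 ≤ n) {u : ℝ}
    (hu : u ∈ Ioo (0 : ℝ) 1) : 1 / (n : ℝ) ≤ 2 * (1 - blockMid n u) := by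
  refine le_trans ?_ (sub_ceil_div_le_blockMid hn hu)
  gcongr
  have : (⌈(n : ℝ) * u⌉₊ : ℝ) ≤ n := by exact_mod_cast ceil_le hu
  linarith

/-! ### The kernel and its distribution function -/

theorem isProbabilityMeasure_withDensity_ofReal {f : ℝ → ℝ} (hf : Integrable f) (hf0 : ∀ x, 0 ≤ f x)
    (hf1 : ∫ x, f x = 1) :
    IsProbabilityMeasure (volume.withDensity fun x => ENNReal.ofReal (f x)) := by
  constructor
  rw [withDensity_apply _ MeasurableSet.univ, Measure.restrict_univ,
    ← ofReal_integral_eq_lintegral_ofReal hf (Eventually.of_forall hf0), hf1, ENNReal.ofReal_one]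

theorem cdf_withDensity_ofReal {f : ℝ → ℝ} (hf : Integrable f) (hf0 : ∀ x, 0 ≤ f x)
    (hf1 : ∫ x, f x = 1) (t : ℝ) :
    cdf (volume.withDensity fun x => ENNReal.ofReal (f x)) t = ∫ x in Iic t, f x := by
  have := isProbabilityMeasure_withDensity_ofReal hf hf0 hf1
  rw [cdf_eq_real, measureReal_def, withDensity_apply _ measurableSet_Iic,
    ← ofReal_integral_eq_lintegral_ofReal hf.integrableOn (Eventually.of_forall hf0),
    ENNReal.toReal_ofReal (integral_nonneg hf0)]

theorem setIntegral_Iic_comp_sub_div (k : ℝ → ℝ) {b : ℝ} (hb : 0 < b) (x t : ℝ) :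
    ∫ y in Iic t, k ((y - x) / b) = b * kernelCDF k ((t - x) / b) := by
  have h1 : ∀ y, (Iic t).indicator (fun y => k ((y - x) / b)) y =
      (Iic ((t - x) / b)).indicator k ((y - x) / b) := by
    intro y
    have : y ∈ Iic t ↔ (y - x) / b ∈ Iic ((t - x) / b) := by
      simp only [mem_Iic]
      rw [div_le_div_iff_of_pos_right hb, sub_le_sub_iff_right]
    by_cases h : y ∈ Iic t
    · rw [indicator_of_mem h, indicator_of_mem (this.1 h)]
    · rw [indicator_of_notMem h, indicator_of_notMem (fun h' => h (this.2 h'))]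
  rw [← integral_indicator measurableSet_Iic]
  simp_rw [h1]
  rw [integral_sub_right_eq_self (fun y => (Iic ((t - x) / b)).indicator k (y / b)) x,
    Measure.integral_comp_div, integral_indicator measurableSet_Iic, abs_of_pos hb, smul_eq_mul,
    kernelCDF]

theorem kernelEstimator_eq (k : ℝ → ℝ) {n : ℕ} {b : ℝ} (hb : 0 < b) (x : Fin n → ℝ) (t : ℝ) :
    kernelEstimator k b x t = (∑ i, kernelCDF k ((t - x i) / b)) / n := by
  unfold kernelEstimator
  simp_rw [setIntegral_Iic_comp_sub_div k hb, ← Finset.mul_sum]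
  rw [← mul_assoc, one_div_mul_eq_div, mul_comm (n : ℝ) b, div_mul_cancel_left₀ hb.ne',
    inv_mul_eq_div]

/-- A kernel may be replaced by a measurable version without changing the estimator. -/
theorem IsKernelDensity.exists_measurable {k : ℝ → ℝ} (hk : IsKernelDensity k) :
    ∃ k' : ℝ → ℝ, Measurable k' ∧ IsKernelDensity k' ∧
      ∀ (n : ℕ) (b : ℝ) (x : Fin n → ℝ), 0 < b → kernelEstimator k b x = kernelEstimator k' b x := by
  obtain ⟨C, hC⟩ := hk.bounded
  have hm := hk.integrable.aestronglyMeasurable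
  -- Integrability gives only almost everywhere measurability. Clamping the measurable
  -- representative keeps it nonnegative and bounded at every point.
  set k' : ℝ → ℝ := fun x => max 0 (min C (hm.mk k x)) with hk'
  have heq : k =ᵐ[volume] k' := by
    filter_upwards [hm.ae_eq_mk] with x hx
    rw [hk']
    simp only
    rw [← hx, min_eq_right (hC x), max_eq_right (hk.nonneg x)]
  have hcdf : kernelCDF k = kernelCDF k' := by
    ext x
    exact integral_congr_ae (ae_restrict_of_ae heq)
  have hmul : ∀ f : ℝ → ℝ, (fun x => f x * k x) =ᵐ[volume] fun x => f x * k' x := fun f => by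
    filter_upwards [heq] with x hx
    rw [hx]
  have hmk : Measurable (hm.mk k) := hm.stronglyMeasurable_mk.measurable
  refine ⟨k', by fun_prop, ⟨fun x => le_max_left _ _, ⟨max 0 C, fun x => ?_⟩,
    hk.integrable.congr heq, ?_, hk.integrable_sq.congr (hmul _), ?_, ?_⟩, ?_⟩
  · exact max_le_max le_rfl (min_le_left _ _)
  · rw [← integral_congr_ae heq, hk.integral_eq_one]
  · rw [← integral_congr_ae (hmul _), hk.mean_zero]
  · rw [← hcdf]
    exact hk.differentiable_cdf
  · intro n b x hb
    ext t
    rw [kernelEstimator_eq k hb, kernelEstimator_eq k' hb, hcdf]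

section Kernel

variable {k : ℝ → ℝ} (hk : IsKernelDensity k)
include hk

theorem IsKernelDensity.kernelCDF_eq_cdf :
    kernelCDF k = cdf (volume.withDensity fun x => ENNReal.ofReal (k x)) := by
  ext t
  rw [cdf_withDensity_ofReal hk.integrable hk.nonneg hk.integral_eq_one, kernelCDF]

theorem IsKernelDensity.integrable_mul_id : Integrable fun x => x * k x := by
  refine (hk.integrable.add hk.integrable_sq).mono'
    (aestronglyMeasurable_id.mul hk.integrable.aestronglyMeasurable)
    (Eventually.of_forall fun x => ?_)
  rw [Real.norm_eq_abs, abs_mul, abs_of_nonneg (hk.nonneg x)]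
  have : |x| ≤ 1 + x ^ 2 := by
    rw [← sq_abs]
    nlinarith [sq_nonneg (|x| - 1), abs_nonneg x]
  simp only [Pi.add_apply]
  nlinarith [hk.nonneg x]

/-- A nonnegative function with integral zero vanishes almost everywhere, which would make `k` null.
Together with the mirror statement this puts kernel mass on both sides of `0`. -/
theorem IsKernelDensity.not_ae_mul_id_nonneg : ¬ ∀ᵐ x, 0 ≤ x * k x := by
  intro h
  have h1 := (integral_eq_zero_iff_of_nonneg_ae h hk.integrable_mul_id).1 hk.mean_zero
  have h2 : k =ᵐ[volume] 0 := by
    have h0 : ∀ᵐ x : ℝ, x ≠ 0 := by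
      simp [ae_iff]
    filter_upwards [h1, h0] with x hx hx0
    exact (mul_eq_zero.1 hx).resolve_left hx0
  have := hk.integral_eq_one
  rw [integral_congr_ae h2] at this
  simp at this

theorem IsKernelDensity.not_ae_mul_id_nonpos : ¬ ∀ᵐ x, x * k x ≤ 0 := by
  intro h
  refine hk.not_ae_mul_id_nonneg ?_
  have h3 : ∀ᵐ x, 0 ≤ -(x * k x) := by
    filter_upwards [h] with x hx
    linarith
  have h1 := (integral_eq_zero_iff_of_nonneg_ae h3 hk.integrable_mul_id.neg).1
    (by rw [integral_neg, hk.mean_zero, neg_zero])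
  filter_upwards [h1] with x hx
  have : -(x * k x) = 0 := hx
  linarith

/-- Used for endpoint control: every sample point to the left of `t` contributes at least the fixed
fraction `K(0)` to the estimator at `t`. -/
theorem IsKernelDensity.kernelCDF_zero_pos : 0 < kernelCDF k 0 := by
  refine lt_of_le_of_ne (integral_nonneg hk.nonneg) fun h => hk.not_ae_mul_id_nonneg ?_
  have h1 := (integral_eq_zero_iff_of_nonneg hk.nonneg hk.integrable.integrableOn).1 h.symm
  have h2 := (ae_restrict_iff' measurableSet_Iic).1 h1
  filter_upwards [h2] with x hx
  rcases le_total x 0 with h3 | h3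
  · rw [hx h3]
    simp
  · exact mul_nonneg h3 (hk.nonneg x)

theorem IsKernelDensity.kernelCDF_zero_lt_one : kernelCDF k 0 < 1 := by
  have hadd := integral_add_compl (measurableSet_Iic (a := (0 : ℝ))) hk.integrable
  rw [hk.integral_eq_one, compl_Iic] at hadd
  have h0 : 0 ≤ ∫ x in Ioi 0, k x := integral_nonneg hk.nonneg
  rw [kernelCDF]
  refine lt_of_le_of_ne (by linarith) fun h => hk.not_ae_mul_id_nonpos ?_
  have h1 := (integral_eq_zero_iff_of_nonneg hk.nonneg hk.integrable.integrableOn).1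
    (show ∫ x in Ioi 0, k x = 0 by linarith)
  have h2 := (ae_restrict_iff' measurableSet_Ioi).1 h1
  filter_upwards [h2] with x hx
  rcases le_or_gt x 0 with h3 | h3
  · exact mul_nonpos_of_nonpos_of_nonneg h3 (hk.nonneg x)
  · rw [hx h3]
    simp

theorem IsKernelDensity.monotone_kernelCDF : Monotone (kernelCDF k) := by
  rw [hk.kernelCDF_eq_cdf]
  exact monotone_cdf _

theorem IsKernelDensity.kernelCDF_nonneg (x : ℝ) : 0 ≤ kernelCDF k x := by
  rw [hk.kernelCDF_eq_cdf]
  exact cdf_nonneg _ _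

theorem IsKernelDensity.kernelCDF_le_one (x : ℝ) : kernelCDF k x ≤ 1 := by
  rw [hk.kernelCDF_eq_cdf]
  exact cdf_le_one _ _

/-- The density of the kernel estimator. -/
def kernelSampleDensity (k : ℝ → ℝ) {n : ℕ} (b : ℝ) (x : Fin n → ℝ) (y : ℝ) : ℝ :=
  1 / (n * b) * ∑ i, k ((y - x i) / b)

/-- The law whose distribution function is the kernel estimator. -/
def kernelSampleMeasure (k : ℝ → ℝ) {n : ℕ} (b : ℝ) (x : Fin n → ℝ) : Measure ℝ :=
  volume.withDensity fun y => ENNReal.ofReal (kernelSampleDensity k b x y)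

theorem IsKernelDensity.integrable_comp_sub_div {b : ℝ} (hb : 0 < b) (x : ℝ) :
    Integrable fun y => k ((y - x) / b) :=
  (hk.integrable.comp_div hb.ne').comp_sub_right x

theorem IsKernelDensity.integral_comp_sub_div {b : ℝ} (hb : 0 < b) (x : ℝ) :
    ∫ y, k ((y - x) / b) = b := by
  rw [integral_sub_right_eq_self (fun y => k (y / b)) x, Measure.integral_comp_div,
    hk.integral_eq_one, abs_of_pos hb, smul_eq_mul, mul_one]

variable {n : ℕ} {b : ℝ} (hb : 0 < b) (x : Fin n → ℝ)
include hb

theorem IsKernelDensity.kernelSampleDensity_nonneg (y : ℝ) : 0 ≤ kernelSampleDensity k b x y :=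
  mul_nonneg (by positivity) (Finset.sum_nonneg fun i _ => hk.nonneg _)

theorem IsKernelDensity.integrable_kernelSampleDensity :
    Integrable (kernelSampleDensity k b x) :=
  (integrable_finsetSum _ fun i _ => hk.integrable_comp_sub_div hb (x i)).const_mul _

theorem IsKernelDensity.integral_kernelSampleDensity (hn : 1 ≤ n) :
    ∫ y, kernelSampleDensity k b x y = 1 := by
  have hn0 : (0 : ℝ) < n := by exact_mod_cast hn
  unfold kernelSampleDensity
  rw [integral_const_mul, integral_finsetSum _ fun i _ => hk.integrable_comp_sub_div hb (x i)]
  simp_rw [hk.integral_comp_sub_div hb]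
  simp only [Finset.sum_const, Finset.card_univ, Fintype.card_fin, nsmul_eq_mul]
  field_simp

theorem IsKernelDensity.isProbabilityMeasure_kernelSampleMeasure (hn : 1 ≤ n) :
    IsProbabilityMeasure (kernelSampleMeasure k b x) :=
  isProbabilityMeasure_withDensity_ofReal (hk.integrable_kernelSampleDensity hb x)
    (hk.kernelSampleDensity_nonneg hb x) (hk.integral_kernelSampleDensity hb x hn)

theorem IsKernelDensity.kernelEstimator_eq_cdf (hn : 1 ≤ n) :
    kernelEstimator k b x = cdf (kernelSampleMeasure k b x) := by
  ext t
  rw [kernelSampleMeasure, cdf_withDensity_ofReal (hk.integrable_kernelSampleDensity hb x)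
    (hk.kernelSampleDensity_nonneg hb x) (hk.integral_kernelSampleDensity hb x hn)]
  unfold kernelSampleDensity
  rw [integral_const_mul,
    integral_finsetSum _ fun i _ => (hk.integrable_comp_sub_div hb (x i)).integrableOn,
    kernelEstimator]

end Kernel

/-! ### Endpoint weights smoothed by the kernel -/

/-- The endpoint weight smoothed by the kernel,
`s ↦ b⁻¹ ∫_0^1 (y^{-γ} + (1 - y)^{-γ}) k ((y - s) / b) dy`. -/
def smoothedWeight (k : ℝ → ℝ) (γ b s : ℝ) : ℝ :=
  b⁻¹ * ∫ y in Ioo (0 : ℝ) 1, endpointWeight γ y * k ((y - s) / b)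

section Smoothed

variable {k : ℝ → ℝ} {γ b : ℝ}

theorem measurable_smoothedWeight (hkm : Measurable k) (γ b : ℝ) :
    Measurable (smoothedWeight k γ b) := by
  have h : Measurable fun p : ℝ × ℝ => endpointWeight γ p.2 * k ((p.2 - p.1) / b) :=
    ((measurable_endpointWeight γ).comp measurable_snd).mul
      (hkm.comp ((measurable_snd.sub measurable_fst).div_const b))
  exact (h.stronglyMeasurable.integral_prod_right
    (ν := volume.restrict (Ioo (0 : ℝ) 1))).measurable.const_mul _

theorem smoothedWeight_nonneg (hk : IsKernelDensity k) (hb : 0 < b) (s : ℝ) :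
    0 ≤ smoothedWeight k γ b s :=
  mul_nonneg (by positivity) (setIntegral_nonneg measurableSet_Ioo fun y hy =>
    mul_nonneg (endpointWeight_nonneg γ hy) (hk.nonneg _))

theorem integrableOn_endpointWeight_mul (hk : IsKernelDensity k) (hkm : Measurable k)
    (hγ : γ < 1) (b s : ℝ) :
    IntegrableOn (fun y => endpointWeight γ y * k ((y - s) / b)) (Ioo (0 : ℝ) 1) := by
  obtain ⟨C, hC⟩ := hk.bounded
  refine (integrableOn_endpointWeight hγ).mul_bdd (c := C) ?_ ?_
  · exact (hkm.comp ((measurable_id.sub_const s).div_const b)).aestronglyMeasurable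
  · refine Eventually.of_forall fun y => ?_
    rw [Real.norm_eq_abs, abs_of_nonneg (hk.nonneg _)]
    exact hC _

/-- Split the weight at the scale `β = b`: the bounded part is integrated against the kernel mass,
the singular part against the supremum of `k`. Any exponent of `b⁻¹` below one is enough later. -/
theorem exists_smoothedWeight_le (hk : IsKernelDensity k) (hkm : Measurable k) (hγ0 : 0 < γ)
    (hγ1 : γ < 1) :
    ∃ L : ℝ, 0 < L ∧ ∀ b : ℝ, 0 < b → b ≤ 1 → ∀ s,
      smoothedWeight k γ b s ≤ L * b ^ (-((1 + γ) / 2)) := by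
  obtain ⟨C, hC⟩ := hk.bounded
  set γ' : ℝ := (1 + γ) / 2 with hγ'
  have hγ'1 : γ' < 1 := by linarith
  have hγγ' : γ ≤ γ' := by linarith
  have hC0 : 0 ≤ C := (hk.nonneg 0).trans (hC 0)
  set I := ∫ y in Ioo (0 : ℝ) 1, endpointWeight γ' y with hI
  have hI0 : 0 ≤ I := setIntegral_nonneg measurableSet_Ioo fun y hy => endpointWeight_nonneg γ' hy
  refine ⟨2 + C * I, by positivity, fun b hb hb1 s => ?_⟩
  have hki : Integrable fun y => k ((y - s) / b) := hk.integrable_comp_sub_div hb s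
  have hp : 0 ≤ b ^ (-γ) := by positivity
  have hp' : 0 ≤ b ^ (γ' - γ) := by positivity
  have h1 : ∫ y in Ioo (0 : ℝ) 1, endpointWeight γ y * k ((y - s) / b) ≤
      2 * b ^ (-γ) * b + b ^ (γ' - γ) * C * I := by
    calc ∫ y in Ioo (0 : ℝ) 1, endpointWeight γ y * k ((y - s) / b)
        ≤ ∫ y in Ioo (0 : ℝ) 1, (2 * b ^ (-γ) * k ((y - s) / b)
          + b ^ (γ' - γ) * C * endpointWeight γ' y) := by
          refine setIntegral_mono_on (integrableOn_endpointWeight_mul hk hkm hγ1 b s)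
            ((hki.integrableOn.const_mul _).add
              ((integrableOn_endpointWeight hγ'1).const_mul _)) measurableSet_Ioo fun y hy => ?_
          have h2 := endpointWeight_le_add hγ0.le hγγ' hb hy
          have h3 := hk.nonneg ((y - s) / b)
          have h4 := hC ((y - s) / b)
          have h5 := mul_nonneg hp' (endpointWeight_nonneg γ' hy)
          have h6 := mul_le_mul_of_nonneg_right h2 h3
          have h7 := mul_le_mul_of_nonneg_left h4 h5
          linarith
      _ = 2 * b ^ (-γ) * (∫ y in Ioo (0 : ℝ) 1, k ((y - s) / b)) + b ^ (γ' - γ) * C * I := by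
          rw [integral_add (hki.integrableOn.const_mul _)
            ((integrableOn_endpointWeight hγ'1).const_mul _), integral_const_mul,
            integral_const_mul]
      _ ≤ _ := by
          gcongr
          exact (setIntegral_le_integral hki (Eventually.of_forall fun y => hk.nonneg _)).trans
            (hk.integral_comp_sub_div hb s).le
  have h8 : b ^ (-γ) ≤ b ^ (-γ') := Real.rpow_le_rpow_of_exponent_ge hb hb1 (by linarith)
  have h9 : b⁻¹ * b ^ (γ' - γ) = b ^ (-γ') := by
    rw [← Real.rpow_neg_one, ← Real.rpow_add hb]
    congr 1
    linarith
  calc smoothedWeight k γ b s ≤ b⁻¹ * (2 * b ^ (-γ) * b + b ^ (γ' - γ) * C * I) := by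
        unfold smoothedWeight
        gcongr
    _ = 2 * b ^ (-γ) * (b⁻¹ * b) + b⁻¹ * b ^ (γ' - γ) * (C * I) := by ring
    _ = 2 * b ^ (-γ) + b ^ (-γ') * (C * I) := by rw [inv_mul_cancel₀ hb.ne', h9, mul_one]
    _ ≤ 2 * b ^ (-γ') + b ^ (-γ') * (C * I) := by gcongr
    _ = (2 + C * I) * b ^ (-γ') := by ring

theorem lintegral_comp_sub_div_le (hk : IsKernelDensity k) (hb : 0 < b) (y : ℝ) :
    ∫⁻ s in Ioo (0 : ℝ) 1, ENNReal.ofReal (k ((y - s) / b)) ≤ ENNReal.ofReal b := by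
  have hi : Integrable fun s => k ((y - s) / b) :=
    (hk.integrable.comp_div hb.ne').comp_sub_left y
  calc ∫⁻ s in Ioo (0 : ℝ) 1, ENNReal.ofReal (k ((y - s) / b))
      ≤ ∫⁻ s, ENNReal.ofReal (k ((y - s) / b)) := setLIntegral_le_lintegral _ _
    _ = ENNReal.ofReal (∫ s, k ((y - s) / b)) :=
        (ofReal_integral_eq_lintegral_ofReal hi (Eventually.of_forall fun s => hk.nonneg _)).symm
    _ = ENNReal.ofReal b := by
        rw [integral_sub_left_eq_self (fun s => k (s / b)) volume y, Measure.integral_comp_div,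
          hk.integral_eq_one, abs_of_pos hb, smul_eq_mul, mul_one]

/-- Tonelli: for fixed `y`, `b⁻¹ k ((y - s) / b)` has integral at most one in `s`. -/
theorem integral_smoothedWeight_le (hk : IsKernelDensity k) (hkm : Measurable k) (hγ : γ < 1)
    (hb : 0 < b) :
    ∫ s in Ioo (0 : ℝ) 1, smoothedWeight k γ b s ≤
      ∫ y in Ioo (0 : ℝ) 1, endpointWeight γ y := by
  set μ := volume.restrict (Ioo (0 : ℝ) 1) with hμ
  have hW := integrableOn_endpointWeight hγ
  have hmem : ∀ᵐ y ∂μ, y ∈ Ioo (0 : ℝ) 1 := ae_restrict_mem measurableSet_Ioo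
  have hW0 : 0 ≤ᵐ[μ] endpointWeight γ := by
    filter_upwards [hmem] with y hy
    exact endpointWeight_nonneg γ hy
  have h0 : ∀ s, ENNReal.ofReal (smoothedWeight k γ b s) =
      ENNReal.ofReal b⁻¹ * ∫⁻ y, ENNReal.ofReal (endpointWeight γ y) *
        ENNReal.ofReal (k ((y - s) / b)) ∂μ := by
    intro s
    rw [smoothedWeight, ENNReal.ofReal_mul (by positivity),
      ofReal_integral_eq_lintegral_ofReal (integrableOn_endpointWeight_mul hk hkm hγ b s)]
    · congr 1
      refine lintegral_congr_ae ?_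
      filter_upwards [hW0] with y hy
      exact ENNReal.ofReal_mul hy
    · filter_upwards [hW0] with y hy
      exact mul_nonneg hy (hk.nonneg _)
  have hmeas : Measurable fun p : ℝ × ℝ => ENNReal.ofReal (endpointWeight γ p.2) *
        ENNReal.ofReal (k ((p.2 - p.1) / b)) :=
    ((measurable_endpointWeight γ).comp measurable_snd).ennreal_ofReal.mul
      (hkm.comp ((measurable_snd.sub measurable_fst).div_const b)).ennreal_ofReal
  rw [integral_eq_lintegral_of_nonneg_ae
    (Eventually.of_forall fun s => smoothedWeight_nonneg hk hb s)
    (measurable_smoothedWeight hkm γ b).aestronglyMeasurable,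
    integral_eq_lintegral_of_nonneg_ae hW0 (measurable_endpointWeight γ).aestronglyMeasurable]
  refine ENNReal.toReal_mono hW.lintegral_lt_top.ne ?_
  simp_rw [h0]
  rw [lintegral_const_mul' _ _ ENNReal.ofReal_ne_top, lintegral_lintegral_swap hmeas.aemeasurable,
    ← lintegral_const_mul' _ _ ENNReal.ofReal_ne_top]
  refine lintegral_mono fun y => ?_
  rw [lintegral_const_mul' _ _ ENNReal.ofReal_ne_top]
  calc ENNReal.ofReal b⁻¹ * (ENNReal.ofReal (endpointWeight γ y) *
        ∫⁻ s, ENNReal.ofReal (k ((y - s) / b)) ∂μ)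
      ≤ ENNReal.ofReal b⁻¹ * (ENNReal.ofReal (endpointWeight γ y) * ENNReal.ofReal b) := by
        gcongr
        exact lintegral_comp_sub_div_le hk hb y
    _ = ENNReal.ofReal (endpointWeight γ y) * (ENNReal.ofReal b⁻¹ * ENNReal.ofReal b) := by ring
    _ = ENNReal.ofReal (endpointWeight γ y) := by
        rw [← ENNReal.ofReal_mul (by positivity), inv_mul_cancel₀ hb.ne', ENNReal.ofReal_one,
          mul_one]

variable {n : ℕ}

theorem integrable_indicator_endpointWeight (hk : IsKernelDensity k) (hkm : Measurable k)
    (hγ : γ < 1) (hb : 0 < b) (x : Fin n → ℝ) :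
    Integrable (fun y => kernelSampleDensity k b x y *
      (Ioo (0 : ℝ) 1).indicator (endpointWeight γ) y) ∧
    ∫ y, kernelSampleDensity k b x y * (Ioo (0 : ℝ) 1).indicator (endpointWeight γ) y =
      (∑ i, smoothedWeight k γ b (x i)) / n := by
  have h1 : (fun y => kernelSampleDensity k b x y *
      (Ioo (0 : ℝ) 1).indicator (endpointWeight γ) y) =
      (Ioo (0 : ℝ) 1).indicator fun y => 1 / (n * b) *
        ∑ i, endpointWeight γ y * k ((y - x i) / b) := by
    ext y
    by_cases hy : y ∈ Ioo (0 : ℝ) 1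
    · rw [indicator_of_mem hy, indicator_of_mem hy, kernelSampleDensity, ← Finset.mul_sum]
      ring
    · rw [indicator_of_notMem hy, indicator_of_notMem hy, mul_zero]
  have h2 : ∀ i ∈ Finset.univ, IntegrableOn
      (fun y => endpointWeight γ y * k ((y - x i) / b)) (Ioo (0 : ℝ) 1) := fun i _ =>
    integrableOn_endpointWeight_mul hk hkm hγ b (x i)
  rw [h1, integral_indicator measurableSet_Ioo, integrable_indicator_iff measurableSet_Ioo]
  refine ⟨(integrable_finsetSum _ h2).const_mul _, ?_⟩
  rw [integral_const_mul, integral_finsetSum _ h2]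
  unfold smoothedWeight
  rw [← Finset.mul_sum]
  field_simp

/-- The integral of the endpoint weight along the quantile function of the kernel estimator. -/
theorem integrableOn_endpointWeight_leftInverse (hk : IsKernelDensity k) (hkm : Measurable k)
    (hγ : γ < 1) (hn : 1 ≤ n) (hb : 0 < b) (x : Fin n → ℝ) :
    IntegrableOn (fun u => (Ioo (0 : ℝ) 1).indicator (endpointWeight γ)
      (leftInverse (kernelEstimator k b x) u)) (Ioo (0 : ℝ) 1) ∧
    ∫ u in Ioo (0 : ℝ) 1, (Ioo (0 : ℝ) 1).indicator (endpointWeight γ)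
      (leftInverse (kernelEstimator k b x) u) = (∑ i, smoothedWeight k γ b (x i)) / n := by
  have := hk.isProbabilityMeasure_kernelSampleMeasure hb x hn
  have hq := aemeasurable_leftInverse_cdf (kernelSampleMeasure k b x)
  have hmap := map_leftInverse_cdf (kernelSampleMeasure k b x)
  rw [hk.kernelEstimator_eq_cdf hb x hn]
  have hwm : Measurable ((Ioo (0 : ℝ) 1).indicator (endpointWeight γ)) :=
    (measurable_endpointWeight γ).indicator measurableSet_Ioo
  have hdm : Measurable fun y => ENNReal.ofReal (kernelSampleDensity k b x y) := by
    unfold kernelSampleDensity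
    fun_prop
  obtain ⟨h1, h2⟩ := integrable_indicator_endpointWeight hk hkm hγ hb x
  have hlt : ∀ᵐ y : ℝ, ENNReal.ofReal (kernelSampleDensity k b x y) < ∞ :=
    Eventually.of_forall fun y => ENNReal.ofReal_lt_top
  have htr : ∀ y, (ENNReal.ofReal (kernelSampleDensity k b x y)).toReal =
      kernelSampleDensity k b x y := fun y =>
    ENNReal.toReal_ofReal (hk.kernelSampleDensity_nonneg hb x y)
  constructor
  -- The quantile function carries the uniform law to the kernel law, so the integral becomes one
  -- against the sample density.
  · refine (integrable_map_measure hwm.aestronglyMeasurable hq).1 ?_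
    rw [hmap, kernelSampleMeasure, integrable_withDensity_iff_integrable_smul' hdm hlt]
    simpa only [htr, smul_eq_mul] using h1
  · rw [← integral_map hq hwm.aestronglyMeasurable, hmap, kernelSampleMeasure,
      integral_withDensity_eq_integral_toReal_smul hdm hlt, ← h2]
    simp only [htr, smul_eq_mul]

end Smoothed

/-! ### Asymptotics of the kernel estimator -/

section Asymptotics

variable {k : ℝ → ℝ} {b : ℕ → ℝ}

/-- Each sample point below `t - δ` contributes at least `K(δ / b)`. The case `δ = 0` serves the
endpoints; a fixed `δ > 0`, where `K(δ / b) → 1`, serves convergence. -/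
theorem kernelCDF_mul_le_kernelEstimator (hk : IsKernelDensity k) {n : ℕ} {b : ℝ}
    (hb : 0 < b) {δ : ℝ} (x : ℕ → ℝ) (t : ℝ) :
    kernelCDF k (δ / b) * ((∑ i ∈ Finset.range n,
      (Iic (t - δ)).indicator (fun _ => (1 : ℝ)) (x i)) / n) ≤
      kernelEstimator k b (fun i : Fin n => x i) t := by
  rw [kernelEstimator_eq k hb, ← mul_div_assoc,
    Fin.sum_univ_eq_sum_range (fun i => kernelCDF k ((t - x i) / b)), Finset.mul_sum]
  gcongr with i
  by_cases h : x i ∈ Iic (t - δ)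
  · rw [indicator_of_mem h, mul_one]
    refine hk.monotone_kernelCDF ?_
    gcongr
    have : x i ≤ t - δ := h
    linarith
  · rw [indicator_of_notMem h, mul_zero]
    exact hk.kernelCDF_nonneg _

theorem one_sub_kernelCDF_zero_mul_le (hk : IsKernelDensity k) {n : ℕ} (hn : 1 ≤ n) {b : ℝ}
    (hb : 0 < b) (x : ℕ → ℝ) (t : ℝ) :
    (1 - kernelCDF k 0) * ((∑ i ∈ Finset.range n,
      (Ici t).indicator (fun _ => (1 : ℝ)) (x i)) / n) ≤
      1 - kernelEstimator k b (fun i : Fin n => x i) t := by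
  have hn0 : (0 : ℝ) < n := by exact_mod_cast hn
  have h1 : 1 - (∑ i ∈ Finset.range n, kernelCDF k ((t - x i) / b)) / n =
      (∑ i ∈ Finset.range n, (1 - kernelCDF k ((t - x i) / b))) / n := by
    rw [Finset.sum_sub_distrib, sub_div]
    simp [hn0.ne']
  rw [kernelEstimator_eq k hb, ← mul_div_assoc,
    Fin.sum_univ_eq_sum_range (fun i => kernelCDF k ((t - x i) / b)), Finset.mul_sum, h1]
  gcongr with i
  by_cases h : x i ∈ Ici t
  · rw [indicator_of_mem h, mul_one]
    have h2 : t ≤ x i := h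
    have : kernelCDF k ((t - x i) / b) ≤ kernelCDF k 0 :=
      hk.monotone_kernelCDF (div_nonpos_of_nonpos_of_nonneg (by linarith) hb.le)
    linarith
  · rw [indicator_of_notMem h, mul_zero]
    linarith [hk.kernelCDF_le_one ((t - x i) / b)]

/-- Points up to `s` contribute at most `1` each, the others at most `K((t - s) / b)`, which
vanishes in the limit when `t < s`. -/
theorem kernelEstimator_le (hk : IsKernelDensity k) {n : ℕ} (hn : 1 ≤ n) {b : ℝ}
    (hb : 0 < b) (x : ℕ → ℝ) (s t : ℝ) :
    kernelEstimator k b (fun i : Fin n => x i) t ≤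
      (∑ i ∈ Finset.range n, (Iic s).indicator (fun _ => (1 : ℝ)) (x i)) / n
        + kernelCDF k ((t - s) / b) := by
  have hn0 : (0 : ℝ) < n := by exact_mod_cast hn
  have h1 : kernelCDF k ((t - s) / b) = (∑ i ∈ Finset.range n, kernelCDF k ((t - s) / b)) / n := by
    rw [Finset.sum_const, Finset.card_range, nsmul_eq_mul, mul_div_cancel_left₀ _ hn0.ne']
  rw [h1, kernelEstimator_eq k hb,
    Fin.sum_univ_eq_sum_range (fun i => kernelCDF k ((t - x i) / b)), ← add_div,
    ← Finset.sum_add_distrib]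
  gcongr with i
  by_cases h : x i ∈ Iic s
  · rw [indicator_of_mem h]
    linarith [hk.kernelCDF_le_one ((t - x i) / b), hk.kernelCDF_nonneg ((t - s) / b)]
  · rw [indicator_of_notMem h, zero_add]
    refine hk.monotone_kernelCDF ?_
    rw [mem_Iic, not_le] at h
    gcongr

/-- The kernel estimator of a sample whose empirical distribution function converges to the
identity at rational points converges to the identity. -/
theorem tendsto_kernelEstimator (hk : IsKernelDensity k) (hb : IsBandwidth b) {x : ℕ → ℝ}
    (hx : ∀ s : ℚ, (s : ℝ) ∈ Ioo (0 : ℝ) 1 → Tendsto (fun n : ℕ => (∑ i ∈ Finset.range n,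
      (Iic (s : ℝ)).indicator (fun _ => (1 : ℝ)) (x i)) / n) atTop (𝓝 s)) {t : ℝ}
    (ht : t ∈ Ioo (0 : ℝ) 1) :
    Tendsto (fun n => kernelEstimator k (b n) (fun i : Fin n => x i) t) atTop (𝓝 t) := by
  have hb0 : Tendsto b atTop (𝓝[>] 0) := tendsto_nhdsWithin_iff.2 ⟨hb.tendsto_zero, by
    filter_upwards [eventually_ge_atTop 1] with n hn
    exact hb.pos n hn⟩
  have hbinv : Tendsto (fun n => (b n)⁻¹) atTop atTop := tendsto_inv_nhdsGT_zero.comp hb0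
  refine tendsto_order.2 ⟨fun a ha => ?_, fun a ha => ?_⟩
  · obtain ⟨s, h1, h2⟩ := exists_rat_btwn (max_lt ha ht.1)
    have hs : (s : ℝ) ∈ Ioo (0 : ℝ) 1 := ⟨(le_max_right _ _).trans_lt h1, h2.trans ht.2⟩
    have hK : Tendsto (fun n => kernelCDF k ((t - s) / b n)) atTop (𝓝 1) := by
      rw [hk.kernelCDF_eq_cdf]
      exact (tendsto_cdf_atTop _).comp (hbinv.const_mul_atTop (by linarith : 0 < t - (s : ℝ)))
    have h3 := hK.mul (hx s hs)
    rw [one_mul] at h3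
    filter_upwards [h3.eventually (lt_mem_nhds ((le_max_left _ _).trans_lt h1)),
      eventually_ge_atTop 1] with n h4 hn
    refine h4.trans_le ?_
    have := kernelCDF_mul_le_kernelEstimator hk (n := n) (δ := t - s) (hb.pos n hn) x t
    rwa [sub_sub_cancel] at this
  · obtain ⟨s, h1, h2⟩ := exists_rat_btwn (lt_min ha ht.2)
    have hs : (s : ℝ) ∈ Ioo (0 : ℝ) 1 := ⟨ht.1.trans h1, h2.trans_le (min_le_right _ _)⟩
    have hK : Tendsto (fun n => kernelCDF k ((t - s) / b n)) atTop (𝓝 0) := by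
      rw [hk.kernelCDF_eq_cdf]
      exact (tendsto_cdf_atBot _).comp
        (hbinv.const_mul_atTop_of_neg (by linarith : t - (s : ℝ) < 0))
    have h3 := (hx s hs).add hK
    rw [add_zero] at h3
    filter_upwards [h3.eventually (gt_mem_nhds (h2.trans_le (min_le_left _ _))),
      eventually_ge_atTop 1] with n h4 hn
    exact (kernelEstimator_le hk hn (hb.pos n hn) x s t).trans_lt h4

end Asymptotics

/-! ### Almost sure properties of the sample near the ends and at rational points -/

/-- The first `n` points of the sequence `x` fill both ends of `(0, 1)`: for all `j ≤ n`, at least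
`j` of them are within `2 (j / n) ^ (1 - ε)` of `0`, and at least `j` are that close to `1`. -/
structure FillsEnds (ε : ℝ) (x : ℕ → ℝ) (n : ℕ) : Prop where
  left : ∀ j : ℕ, 1 ≤ j → j ≤ n → 2 * ((j : ℝ) / n) ^ (1 - ε) < 1 →
    (j : ℝ) ≤ ∑ i ∈ Finset.range n,
      (Iic (2 * ((j : ℝ) / n) ^ (1 - ε))).indicator (fun _ => (1 : ℝ)) (x i)
  right : ∀ j : ℕ, 1 ≤ j → j ≤ n → 2 * ((j : ℝ) / n) ^ (1 - ε) < 1 →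
    (j : ℝ) ≤ ∑ i ∈ Finset.range n,
      (Ici (1 - 2 * ((j : ℝ) / n) ^ (1 - ε))).indicator (fun _ => (1 : ℝ)) (x i)

theorem ae_eventually_fillsEnds {Ω : Type*} [MeasurableSpace Ω] {P : Measure Ω}
    [IsProbabilityMeasure P] {ξ : ℕ → Ω → ℝ} (hξ_meas : ∀ i, Measurable (ξ i))
    (hξ_indep : iIndepFun ξ P) (hξ_unif : ∀ i, pdf.IsUniform (ξ i) (Ioo (0 : ℝ) 1) P volume)
    {ε : ℝ} (hε0 : 0 < ε) (hε1 : ε < 1) :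
    ∀ᵐ ω ∂P, ∀ᶠ n in atTop, FillsEnds ε (fun i => ξ i ω) n := by
  filter_upwards [ae_eventually_le_sum_indicator hξ_meas hξ_indep hξ_unif
      (fun t => measurableSet_Iic (a := t))
      (fun t ht => volume_restrict_real_Iic (Ioo_subset_Icc_self ht)) hε0 hε1,
    ae_eventually_le_sum_indicator hξ_meas hξ_indep hξ_unif
      (fun t => measurableSet_Ici (a := 1 - t))
      (fun t ht => volume_restrict_real_Ici ht) hε0 hε1] with ω h1 h2
  filter_upwards [h1, h2] with n h3 h4
  exact ⟨h3, h4⟩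

/-- Countably many points `s` share one null set in the strong law; monotonicity handles the others
later. -/
theorem ae_tendsto_empirical {Ω : Type*} [MeasurableSpace Ω] {P : Measure Ω}
    {ξ : ℕ → Ω → ℝ} (hξ_meas : ∀ i, Measurable (ξ i))
    (hξ_indep : iIndepFun ξ P) (hξ_unif : ∀ i, pdf.IsUniform (ξ i) (Ioo (0 : ℝ) 1) P volume) :
    ∀ᵐ ω ∂P, ∀ s : ℚ, (s : ℝ) ∈ Ioo (0 : ℝ) 1 →
      Tendsto (fun n : ℕ => (∑ i ∈ Finset.range n,
        (Iic (s : ℝ)).indicator (fun _ => (1 : ℝ)) (ξ i ω)) / n) atTop (𝓝 s) := by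
  rw [ae_all_iff]
  intro s
  by_cases hs : (s : ℝ) ∈ Ioo (0 : ℝ) 1
  · have h := ae_tendsto_sum_comp_div hξ_meas hξ_indep hξ_unif
      (ψ := (Iic (s : ℝ)).indicator fun _ => (1 : ℝ)) (measurable_const.indicator measurableSet_Iic)
      ((integrable_const 1).indicator measurableSet_Iic)
    rw [integral_indicator_const _ measurableSet_Iic,
      volume_restrict_real_Iic (Ioo_subset_Icc_self hs), smul_eq_mul, mul_one] at h
    filter_upwards [h] with ω hω _
    exact hω
  · exact Eventually.of_forall fun ω h => absurd h hs

/-! ### The kernel statistic -/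

/-- With `t = 2 (j/n)^(1-ε)`, the estimator at `t` is at least `K(0) j / n`; so `u < K(0) j / n`
puts the quantile at or below `t`. The right end is the mirror image with `1 - K(0)`. -/
theorem leftInverse_kernelEstimator_bounds {k : ℝ → ℝ} (hk : IsKernelDensity k) {n : ℕ}
    (hn : 1 ≤ n) {b ε : ℝ} (hb : 0 < b) (hε0 : 0 < ε) (hε1 : ε < 1) {x : ℕ → ℝ}
    (hx : FillsEnds ε x n) {u : ℝ} (hu : u ∈ Ioo (0 : ℝ) 1)
    (hq : leftInverse (kernelEstimator k b fun i : Fin n => x i) u ∈ Ioo (0 : ℝ) 1) :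
    leftInverse (kernelEstimator k b fun i : Fin n => x i) u ≤
        8 / kernelCDF k 0 * blockMid n u ^ (1 - ε) ∧
      1 - leftInverse (kernelEstimator k b fun i : Fin n => x i) u ≤
        8 / (1 - kernelCDF k 0) * (1 - blockMid n u) ^ (1 - ε) := by
  have hn0 : (0 : ℝ) < n := by exact_mod_cast hn
  have hF := hk.kernelEstimator_eq_cdf hb (fun i : Fin n => x i) hn
  have hiff : ∀ t, leftInverse (kernelEstimator k b fun i : Fin n => x i) u ≤ t ↔
      u ≤ kernelEstimator k b (fun i : Fin n => x i) t := by
    rw [hF]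
    exact leftInverse_cdf_le_iff _ hu
  have hκ0 := hk.kernelCDF_zero_pos
  have hκ1 := hk.kernelCDF_zero_lt_one
  constructor
  · refine le_mul_rpow_of_forall_block hn hε0 hε1 hκ0 hκ1.le hq.2 hu.1 (le_two_mul_blockMid hn hu)
      (one_div_le_two_mul_blockMid hn hu) fun j hj1 hjn hlt hw => ?_
    rw [hiff]
    have h1 := kernelCDF_mul_le_kernelEstimator hk (n := n) (δ := 0) hb x
      (2 * ((j : ℝ) / n) ^ (1 - ε))
    rw [zero_div, sub_zero] at h1
    refine hw.le.trans (le_trans ?_ h1)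
    gcongr
    exact hx.left j hj1 hjn hlt
  · refine le_mul_rpow_of_forall_block hn hε0 hε1 (by linarith) (by linarith)
      (one_sub_mem_Ioo hq).2 (one_sub_mem_Ioo hu).1 (one_sub_le_two_mul_blockMid hn hu)
      (one_div_le_two_mul_one_sub_blockMid hn hu) fun j hj1 hjn hlt hw => ?_
    have h1 := one_sub_kernelCDF_zero_mul_le hk hn hb x (1 - 2 * ((j : ℝ) / n) ^ (1 - ε))
    have h2 : (1 - kernelCDF k 0) * ((j : ℝ) / n) ≤ (1 - kernelCDF k 0) * ((∑ i ∈ Finset.range n,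
        (Ici (1 - 2 * ((j : ℝ) / n) ^ (1 - ε))).indicator (fun _ => (1 : ℝ)) (x i)) / n) := by
      have := hx.right j hj1 hjn hlt
      have h0 : 0 ≤ 1 - kernelCDF k 0 := by linarith
      gcongr
    by_contra! hgt
    have h3 := (hiff (1 - 2 * ((j : ℝ) / n) ^ (1 - ε))).1 (by linarith)
    linarith

/-- The bandwidth condition enters through `1 / b ≤ n` for large `n`, which turns the supremum bound
in `b` into `L n^((1+γ)/2)`. -/
theorem ae_eventually_sum_smoothedWeight_le {Ω : Type*} [MeasurableSpace Ω] {P : Measure Ω}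
    [IsProbabilityMeasure P] {ξ : ℕ → Ω → ℝ} (hξ_meas : ∀ i, Measurable (ξ i))
    (hξ_indep : iIndepFun ξ P) (hξ_unif : ∀ i, pdf.IsUniform (ξ i) (Ioo (0 : ℝ) 1) P volume)
    {k : ℝ → ℝ} (hk : IsKernelDensity k) (hkm : Measurable k) {b : ℕ → ℝ} (hb : IsBandwidth b)
    {γ : ℝ} (hγ0 : 0 < γ) (hγ1 : γ < 1) :
    ∃ A : ℝ, ∀ᵐ ω ∂P, ∀ᶠ n : ℕ in atTop,
      (∑ i : Fin n, smoothedWeight k γ (b n) (ξ i ω)) / n ≤ A := by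
  obtain ⟨L, hL0, hL⟩ := exists_smoothedWeight_le hk hkm hγ0 hγ1
  have hI0 : 0 ≤ ∫ y in Ioo (0 : ℝ) 1, endpointWeight γ y :=
    setIntegral_nonneg measurableSet_Ioo fun y hy => endpointWeight_nonneg γ hy
  -- Adding `1` ensures a strictly positive bound on the mean.
  refine ⟨3 * ((∫ y in Ioo (0 : ℝ) 1, endpointWeight γ y) + 1), ?_⟩
  have hle : ∀ᶠ n : ℕ in atTop, ∀ s,
      smoothedWeight k γ (b n) s ≤ L * (n : ℝ) ^ ((1 + γ) / 2) := by
    filter_upwards [eventually_ge_atTop 1, hb.tendsto_zero.eventually (gt_mem_nhds zero_lt_one),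
      hb.tendsto_mul_atTop.eventually_ge_atTop 1] with n hn hb1 hnb s
    have hn0 : (0 : ℝ) < n := by exact_mod_cast hn
    have hbn := hb.pos n hn
    refine (hL (b n) hbn hb1.le s).trans ?_
    gcongr
    rw [Real.rpow_neg hbn.le, ← Real.inv_rpow hbn.le]
    refine Real.rpow_le_rpow (by positivity) ?_ (by linarith)
    rw [inv_le_iff_one_le_mul₀ hbn]
    exact hnb
  filter_upwards [ae_eventually_sum_comp_le hξ_meas hξ_indep hξ_unif
    (φ := fun n => smoothedWeight k γ (b n)) (fun n => measurable_smoothedWeight hkm γ (b n))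
    (L := L) (ρ := (1 + γ) / 2) (A := (∫ y in Ioo (0 : ℝ) 1, endpointWeight γ y) + 1) hL0
    (by linarith) (by linarith) (fun n hn s => smoothedWeight_nonneg hk (hb.pos n hn) s) hle
    (fun n hn => (integral_smoothedWeight_le hk hkm hγ1 (hb.pos n hn)).trans
      (by linarith))] with ω hω
  filter_upwards [hω, eventually_ge_atTop 1] with n hn hn1
  have hn0 : (0 : ℝ) < n := by exact_mod_cast hn1
  rw [div_le_iff₀ hn0, Fin.sum_univ_eq_sum_range (fun i => smoothedWeight k γ (b n) (ξ i ω))]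
  exact hn

/-! ### The statistic of the order statistics -/

theorem integrableOn_comp_ceil {n : ℕ} (hn : 1 ≤ n) (Φ : ℕ → ℝ) :
    IntegrableOn (fun u : ℝ => Φ ⌈(n : ℝ) * u⌉₊) (Ioo (0 : ℝ) 1) ∧
      ∫ u in Ioo (0 : ℝ) 1, Φ ⌈(n : ℝ) * u⌉₊ = (∑ i ∈ Finset.range n, Φ (i + 1)) / n := by
  have hn0 : (0 : ℝ) < n := by exact_mod_cast hn
  have hle : ∀ i : ℕ, (i : ℝ) / n ≤ ((i + 1 : ℕ) : ℝ) / n := fun i => by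
    gcongr
    omega
  have hceil : ∀ i : ℕ, ∀ u ∈ Ioc ((i : ℝ) / n) (((i + 1 : ℕ) : ℝ) / n),
      Φ (i + 1) = Φ ⌈(n : ℝ) * u⌉₊ := by
    intro i u hu
    congr 1
    symm
    rw [Nat.ceil_eq_iff (by omega), Nat.add_sub_cancel]
    rw [mem_Ioc, div_lt_iff₀ hn0, le_div_iff₀ hn0] at hu
    rw [mul_comm]
    exact hu
  have hint : ∀ i : ℕ, IntervalIntegrable (fun u : ℝ => Φ ⌈(n : ℝ) * u⌉₊) volume
      ((i : ℝ) / n) (((i + 1 : ℕ) : ℝ) / n) := by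
    intro i
    rw [intervalIntegrable_iff_integrableOn_Ioc_of_le (hle i)]
    exact (integrableOn_const (C := Φ (i + 1)) (by simp)).congr_fun (hceil i) measurableSet_Ioc
  have hval : ∀ i : ℕ, ∫ u in (i : ℝ) / n..((i + 1 : ℕ) : ℝ) / n, Φ ⌈(n : ℝ) * u⌉₊ =
      Φ (i + 1) / n := by
    intro i
    rw [intervalIntegral.integral_of_le (hle i),
      ← setIntegral_congr_fun measurableSet_Ioc (hceil i), setIntegral_const,
      Real.volume_real_Ioc_of_le (hle i), smul_eq_mul]
    push_cast
    ring
  have h0 : ((0 : ℕ) : ℝ) / n = 0 := by simp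
  have h1 : (n : ℝ) / n = 1 := div_self hn0.ne'
  constructor
  · have := IntervalIntegrable.trans_iterate (a := fun i : ℕ => (i : ℝ) / n) (n := n)
      fun i _ => hint i
    simp only [h0, h1] at this
    rwa [intervalIntegrable_iff_integrableOn_Ioo_of_le zero_le_one] at this
  · have := intervalIntegral.sum_integral_adjacent_intervals (a := fun i : ℕ => (i : ℝ) / n)
      (n := n) fun i _ => hint i
    simp only [h0, h1, hval] at this
    rw [intervalIntegral.integral_of_le zero_le_one, integral_Ioc_eq_integral_Ioo] at this
    rw [← this, Finset.sum_div]

/-- The empirical quantile function, as a function of the index of the block. -/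
def blockOrderStat {n : ℕ} (x : Fin n → ℝ) (m : ℕ) : ℝ :=
  -- Only `1 ≤ m ≤ n` occurs for `u` in `(0, 1)` and `n ≥ 1`; block `m` corresponds to the
  -- zero-based index `m - 1`.
  if h : m - 1 < n then orderStat x ⟨m - 1, h⟩ else 0

theorem blockOrderStat_succ {n : ℕ} (x : Fin n → ℝ) (i : Fin n) :
    blockOrderStat x (i + 1) = orderStat x i := by
  unfold blockOrderStat
  rw [dif_pos (by simp)]
  rfl

theorem blockOrderStat_ceil {n : ℕ} (hn : 1 ≤ n) (x : Fin n → ℝ) {u : ℝ}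
    (hu : u ∈ Ioo (0 : ℝ) 1) :
    ∃ j : Fin n, (j : ℕ) + 1 = ⌈(n : ℝ) * u⌉₊ ∧
      blockOrderStat x ⌈(n : ℝ) * u⌉₊ = orderStat x j := by
  have h1 := one_le_ceil hn hu
  have h2 := ceil_le (n := n) hu
  refine ⟨⟨⌈(n : ℝ) * u⌉₊ - 1, by omega⟩, by simp only; omega, ?_⟩
  rw [blockOrderStat, dif_pos]

theorem sum_comp_orderStat {n : ℕ} (x : ℕ → ℝ) (φ : ℝ → ℝ) :
    ∑ i : Fin n, φ (orderStat (fun i : Fin n => x i) i) = ∑ i ∈ Finset.range n, φ (x i) := by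
  rw [← Fin.sum_univ_eq_sum_range (fun i => φ (x i))]
  exact Equiv.sum_comp (Tuple.sort fun i : Fin n => x i) fun i => φ (x i)

/-- Zero-based indexing: more than `j` points must be at most `t`. This plays the role of the Galois
connection. -/
theorem orderStat_le_iff {n : ℕ} (x : ℕ → ℝ) (j : Fin n) (t : ℝ) :
    orderStat (fun i : Fin n => x i) j ≤ t ↔
      ((j : ℕ) : ℝ) < ∑ i ∈ Finset.range n, (Iic t).indicator (fun _ => (1 : ℝ)) (x i) := by
  have h := Tuple.lt_card_le_iff_apply_le_of_monotone (j := j) (a := t)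
    (Tuple.monotone_sort fun i : Fin n => x i)
  rw [← sum_comp_orderStat x]
  simp only [indicator_apply, mem_Iic, Finset.sum_boole, Nat.cast_lt]
  exact h.symm

theorem orderStat_lt_iff {n : ℕ} (x : ℕ → ℝ) (j : Fin n) (t : ℝ) :
    orderStat (fun i : Fin n => x i) j < t ↔
      ((j : ℕ) : ℝ) < ∑ i ∈ Finset.range n, (Iio t).indicator (fun _ => (1 : ℝ)) (x i) := by
  have h := Tuple.lt_card_lt_iff_apply_lt_of_monotone (j := j) (a := t)
    (Tuple.monotone_sort fun i : Fin n => x i)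
  rw [← sum_comp_orderStat x]
  simp only [indicator_apply, mem_Iio, Finset.sum_boole, Nat.cast_lt]
  exact h.symm

theorem blockOrderStat_bounds {n : ℕ} (hn : 1 ≤ n) {ε : ℝ} (hε0 : 0 < ε) (hε1 : ε < 1)
    {x : ℕ → ℝ} (hx : FillsEnds ε x n) {u : ℝ} (hu : u ∈ Ioo (0 : ℝ) 1)
    (hq : blockOrderStat (fun i : Fin n => x i) ⌈(n : ℝ) * u⌉₊ ∈ Ioo (0 : ℝ) 1) :
    blockOrderStat (fun i : Fin n => x i) ⌈(n : ℝ) * u⌉₊ ≤ 8 * blockMid n u ^ (1 - ε) ∧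
      1 - blockOrderStat (fun i : Fin n => x i) ⌈(n : ℝ) * u⌉₊ ≤
        8 * (1 - blockMid n u) ^ (1 - ε) := by
  have hn0 : (0 : ℝ) < n := by exact_mod_cast hn
  obtain ⟨i, hi, hqi⟩ := blockOrderStat_ceil hn (fun i : Fin n => x i) hu
  rw [hqi] at hq ⊢
  have hi' : ((i : ℕ) : ℝ) + 1 = ⌈(n : ℝ) * u⌉₊ := by exact_mod_cast hi
  have hi1 : ((i : ℕ) : ℝ) < n * u := by
    have := Nat.ceil_lt_add_one (mul_pos hn0 hu.1).le
    linarith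
  have hi2 : n * u ≤ ((i : ℕ) : ℝ) + 1 := by
    rw [hi']
    exact Nat.le_ceil _
  rw [← div_one (8 : ℝ)]
  constructor
  · refine le_mul_rpow_of_forall_block hn hε0 hε1 one_pos le_rfl hq.2 hu.1
      (le_two_mul_blockMid hn hu) (one_div_le_two_mul_blockMid hn hu) fun j hj1 hjn hlt hw => ?_
    rw [orderStat_le_iff]
    rw [one_mul, lt_div_iff₀ hn0] at hw
    linarith [hx.left j hj1 hjn hlt]
  · refine le_mul_rpow_of_forall_block hn hε0 hε1 one_pos le_rfl
      (one_sub_mem_Ioo hq).2 (one_sub_mem_Ioo hu).1 (one_sub_le_two_mul_blockMid hn hu)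
      (one_div_le_two_mul_one_sub_blockMid hn hu) fun j hj1 hjn hlt hw => ?_
    -- At least `i + 1` points lie strictly below `1 - t` and at least `j` at or above it, so `i + 1
    -- + j ≤ n`; but `n u ≤ i + 1` and `n (1 - u) < j`.
    by_contra! hgt
    have h1 := (orderStat_lt_iff x i (1 - 2 * ((j : ℝ) / n) ^ (1 - ε))).1 (by linarith)
    have h2 := hx.right j hj1 hjn hlt
    have h3 : (∑ i ∈ Finset.range n,
        (Iio (1 - 2 * ((j : ℝ) / n) ^ (1 - ε))).indicator (fun _ => (1 : ℝ)) (x i)) +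
        ∑ i ∈ Finset.range n,
        (Ici (1 - 2 * ((j : ℝ) / n) ^ (1 - ε))).indicator (fun _ => (1 : ℝ)) (x i) = n := by
      rw [← Finset.sum_add_distrib]
      simp_rw [← compl_Iio, indicator_self_add_compl_apply]
      simp
    rw [one_mul, lt_div_iff₀ hn0] at hw
    have hlt' : ((i : ℕ) : ℝ) + j < n := by linarith
    have hle' : ((i : ℕ) : ℝ) + 1 + j ≤ n := by
      have : (i : ℕ) + j < n := by exact_mod_cast hlt'
      exact_mod_cast (by omega : (i : ℕ) + 1 + j ≤ n)
    linarith

theorem tendsto_blockOrderStat {x : ℕ → ℝ}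
    (hx : ∀ s : ℚ, (s : ℝ) ∈ Ioo (0 : ℝ) 1 → Tendsto (fun n : ℕ => (∑ i ∈ Finset.range n,
      (Iic (s : ℝ)).indicator (fun _ => (1 : ℝ)) (x i)) / n) atTop (𝓝 s)) {u : ℝ}
    (hu : u ∈ Ioo (0 : ℝ) 1) :
    Tendsto (fun n : ℕ => blockOrderStat (fun i : Fin n => x i) ⌈(n : ℝ) * u⌉₊) atTop (𝓝 u) := by
  refine tendsto_order.2 ⟨fun a ha => ?_, fun a ha => ?_⟩
  · obtain ⟨s, h1, h2⟩ := exists_rat_btwn (max_lt ha hu.1)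
    have hs : (s : ℝ) ∈ Ioo (0 : ℝ) 1 := ⟨(le_max_right _ _).trans_lt h1, h2.trans hu.2⟩
    filter_upwards [(hx s hs).eventually (gt_mem_nhds h2), eventually_ge_atTop 1] with n h3 hn
    have hn0 : (0 : ℝ) < n := by exact_mod_cast hn
    obtain ⟨i, hi, hqi⟩ := blockOrderStat_ceil hn (fun i : Fin n => x i) hu
    rw [hqi]
    refine ((le_max_left _ _).trans_lt h1).trans ?_
    by_contra! hle
    rw [orderStat_le_iff] at hle
    rw [div_lt_iff₀ hn0] at h3
    simp only [indicator_apply, Finset.sum_boole, Nat.cast_lt] at hle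
    simp only [indicator_apply, Finset.sum_boole] at h3
    have h4 : (⌈(n : ℝ) * u⌉₊ : ℝ) < n * u := by
      refine lt_of_le_of_lt ?_ ((mul_comm u _) ▸ h3)
      exact_mod_cast (by omega)
    exact absurd (Nat.le_ceil ((n : ℝ) * u)) (not_le.2 h4)
  · obtain ⟨s, h1, h2⟩ := exists_rat_btwn (lt_min ha hu.2)
    have hs : (s : ℝ) ∈ Ioo (0 : ℝ) 1 := ⟨hu.1.trans h1, h2.trans_le (min_le_right _ _)⟩
    filter_upwards [(hx s hs).eventually (lt_mem_nhds h1), eventually_ge_atTop 1] with n h3 hn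
    have hn0 : (0 : ℝ) < n := by exact_mod_cast hn
    obtain ⟨i, hi, hqi⟩ := blockOrderStat_ceil hn (fun i : Fin n => x i) hu
    rw [hqi]
    refine lt_of_le_of_lt ?_ (h2.trans_le (min_le_left _ _))
    rw [orderStat_le_iff]
    rw [lt_div_iff₀ hn0] at h3
    have h4 := Nat.ceil_lt_add_one (mul_pos hn0 hu.1).le
    have hi' : ((i : ℕ) : ℝ) + 1 = ⌈(n : ℝ) * u⌉₊ := by exact_mod_cast hi
    linarith

theorem measurable_blockOrderStat_ceil {n : ℕ} (x : Fin n → ℝ) :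
    Measurable fun u : ℝ => blockOrderStat x ⌈(n : ℝ) * u⌉₊ :=
  (measurable_of_countable (blockOrderStat x)).comp
    (Nat.measurable_ceil.comp (measurable_const.mul measurable_id))

theorem integral_indicator_blockOrderStat {n : ℕ} (hn : 1 ≤ n) {x : ℕ → ℝ}
    (hx : ∀ i, x i ∈ Ioo (0 : ℝ) 1) (w : ℝ → ℝ) :
    IntegrableOn (fun u : ℝ => (Ioo (0 : ℝ) 1).indicator w
      (blockOrderStat (fun i : Fin n => x i) ⌈(n : ℝ) * u⌉₊)) (Ioo (0 : ℝ) 1) ∧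
    ∫ u in Ioo (0 : ℝ) 1, (Ioo (0 : ℝ) 1).indicator w
      (blockOrderStat (fun i : Fin n => x i) ⌈(n : ℝ) * u⌉₊) =
      (∑ i ∈ Finset.range n, w (x i)) / n := by
  obtain ⟨h1, h2⟩ := integrableOn_comp_ceil hn fun m =>
    (Ioo (0 : ℝ) 1).indicator w (blockOrderStat (fun i : Fin n => x i) m)
  refine ⟨h1, h2.trans ?_⟩
  rw [← Fin.sum_univ_eq_sum_range (fun m => (Ioo (0 : ℝ) 1).indicator w
    (blockOrderStat (fun i : Fin n => x i) (m + 1)))]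
  simp_rw [blockOrderStat_succ]
  rw [sum_comp_orderStat x]
  congr 1
  exact Finset.sum_congr rfl fun i _ => indicator_of_mem (hx i) w

theorem lStatistic_eq_integral (g : ℝ → ℝ) (c : ℕ → ℕ → ℝ) {n : ℕ} (hn : 1 ≤ n) {x : ℕ → ℝ}
    (hx : ∀ i, x i ∈ Ioo (0 : ℝ) 1) :
    lStatistic g c (fun i : Fin n => x i) = ∫ u in Ioo (0 : ℝ) 1, (Ioo (0 : ℝ) 1).indicator g
      (blockOrderStat (fun i : Fin n => x i) ⌈(n : ℝ) * u⌉₊) * scoreFun c n u := by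
  have h := (integrableOn_comp_ceil hn fun m => (Ioo (0 : ℝ) 1).indicator g
    (blockOrderStat (fun i : Fin n => x i) m) * c n (max 1 m)).2
  unfold scoreFun
  rw [h, ← Fin.sum_univ_eq_sum_range (fun m => (Ioo (0 : ℝ) 1).indicator g
    (blockOrderStat (fun i : Fin n => x i) (m + 1)) * c n (max 1 (m + 1))), lStatistic,
    one_div_mul_eq_div]
  congr 1
  refine Finset.sum_congr rfl fun i _ => ?_
  rw [blockOrderStat_succ, max_eq_right (by omega)]
  congr 1
  exact (indicator_of_mem (s := Ioo (0 : ℝ) 1) (hx _) g).symm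

end KernelLStat

end

/-! ### The main theorem -/

theorem theorem4 {Ω : Type*} [MeasurableSpace Ω] (P : Measure Ω) [IsProbabilityMeasure P]
    (ξ : ℕ → Ω → ℝ) (hξ_meas : ∀ i, Measurable (ξ i)) (hξ_indep : iIndepFun ξ P)
    (hξ_unif : ∀ i, pdf.IsUniform (ξ i) (Set.Ioo (0 : ℝ) 1) P volume)
    (k : ℝ → ℝ) (hk : IsKernelDensity k)
    (b : ℕ → ℝ) (hb : IsBandwidth b)
    (g : ℝ → ℝ) (hg : IsClassG g)
    (J : ℝ → ℝ) (hJ : Measurable fun t : Set.Ioo (0 : ℝ) 1 => J t)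
    (c : ℕ → ℕ → ℝ)
    (M b₁ b₂ δ : ℝ) (hM : 0 < M) (hb₁ : 0 < b₁) (hb₂ : 0 < b₂) (hδ : 0 < δ)
    (hbound : BoundednessCondition g J hg c M b₁ b₂ δ)
    (hsmooth : SmoothnessCondition g J hg c) :
    IntegrableOn (fun t => J t * g t) (Set.Ioo (0 : ℝ) 1) ∧
    (∀ᵐ ω ∂P, ∀ n, 1 ≤ n → IntegrableOn
      (kernelIntegrand k g c (b n) fun i : Fin n => ξ i ω) (Set.Ioo (0 : ℝ) 1)) ∧
    (∀ᵐ ω ∂P, Tendsto (fun n => kernelStatistic k g c (b n) fun i : Fin n => ξ i ω) atTop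
      (𝓝 (∫ t in Set.Ioo (0 : ℝ) 1, J t * g t))) ∧
    (∀ᵐ ω ∂P, Tendsto (fun n => lStatistic g c fun i : Fin n => ξ i ω) atTop
      (𝓝 (∫ t in Set.Ioo (0 : ℝ) 1, J t * g t))) := by
  obtain ⟨ε, γ, hadm⟩ := exists_admissibleExponents hb₁ hb₂ hδ
  -- The gap between `γ` and `γ'` provides the uniform integrability.
  obtain ⟨γ', hγγ', hγ'1⟩ := exists_between hadm.gamma_lt_one
  have hγ'0 : 0 < γ' := hadm.gamma_pos.trans hγγ'
  obtain ⟨k', hkm, hk', hkk'⟩ := hk.exists_measurable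
  have hest : ∀ n, 1 ≤ n → ∀ x : Fin n → ℝ,
      kernelEstimator k (b n) x = kernelEstimator k' (b n) x := fun n hn x =>
    hkk' n (b n) x (hb.pos n hn)
  have hfill := ae_eventually_fillsEnds hξ_meas hξ_indep hξ_unif hadm.eps_pos hadm.eps_lt_one
  have hemp := ae_tendsto_empirical hξ_meas hξ_indep hξ_unif
  refine ⟨integrableOn_mul hM hb₁ hb₂ hδ hJ hbound, ?_, ?_, ?_⟩
  · refine Eventually.of_forall fun ω n hn => ?_
    have hq := aemeasurable_leftInverse_cdf
      (kernelSampleMeasure k' (b n) fun i : Fin n => ξ i ω)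
    rw [← hk'.kernelEstimator_eq_cdf (hb.pos n hn) _ hn, ← hest n hn] at hq
    have hint := (integrableOn_endpointWeight_leftInverse hk' hkm hadm.gamma_lt_one hn
      (hb.pos n hn) fun i : Fin n => ξ i ω).1
    rw [← hest n hn] at hint
    exact integrableOn_indicator_mul_scoreFun hM hb₁ hb₂ hδ hbound hadm hn hq hint
  · obtain ⟨A, hA⟩ := ae_eventually_sum_smoothedWeight_le hξ_meas hξ_indep hξ_unif hk' hkm hb
      hγ'0 hγ'1
    have hκ0 := hk'.kernelCDF_zero_pos
    have hκ1 := hk'.kernelCDF_zero_lt_one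
    filter_upwards [hA, hfill, hemp] with ω hω hωfill hωemp
    -- Quantiles of `cdf (ν n)` are measurable for every `n`, including `n = 0`, where the
    -- identification with the estimator is not available.
    set ν : ℕ → Measure ℝ := fun n => kernelSampleMeasure k' (b n) fun i : Fin n => ξ i ω with hν
    have hcdf : ∀ n, 1 ≤ n →
        kernelEstimator k' (b n) (fun i : Fin n => ξ i ω) = cdf (ν n) := fun n hn =>
      hk'.kernelEstimator_eq_cdf (hb.pos n hn) _ hn
    have hlim : ∀ t ∈ Set.Ioo (0 : ℝ) 1, Tendsto (fun n => cdf (ν n) t) atTop (𝓝 t) := by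
      intro t ht
      refine (tendsto_kernelEstimator hk' hb hωemp ht).congr' ?_
      filter_upwards [eventually_ge_atTop 1] with n hn
      rw [hcdf n hn]
    have hmain := tendsto_integral_indicator_mul_scoreFun (q := fun n => leftInverse (cdf (ν n)))
      (C := max (8 / kernelCDF k' 0) (8 / (1 - kernelCDF k' 0))) (γ' := γ') (C' := A)
      hM hb₁ hb₂ hδ hJ hbound hsmooth hadm (fun n => aemeasurable_leftInverse_cdf (ν n))
      (fun u hu => tendsto_leftInverse_cdf hlim hu) ?_ ?_ hγγ' hγ'1 ?_ ?_
    · refine hmain.congr' ?_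
      filter_upwards [eventually_ge_atTop 1] with n hn
      unfold kernelStatistic kernelIntegrand
      rw [hest n hn, hcdf n hn]
    · refine le_max_of_le_left ?_
      rw [le_div_iff₀ hκ0]
      linarith
    · filter_upwards [hωfill, eventually_ge_atTop 1] with n hf hn u hu hq
      rw [← hcdf n hn] at hq ⊢
      obtain ⟨h1, h2⟩ := leftInverse_kernelEstimator_bounds hk' hn (hb.pos n hn) hadm.eps_pos
        hadm.eps_lt_one hf hu hq
      have hv := blockMid_mem_Ioo hn hu
      have hv0 := Real.rpow_nonneg hv.1.le (1 - ε)
      have hv1 := Real.rpow_nonneg (one_sub_mem_Ioo hv).1.le (1 - ε)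
      exact ⟨h1.trans (mul_le_mul_of_nonneg_right (le_max_left _ _) hv0),
        h2.trans (mul_le_mul_of_nonneg_right (le_max_right _ _) hv1)⟩
    · filter_upwards [eventually_ge_atTop 1] with n hn
      rw [← hcdf n hn]
      exact (integrableOn_endpointWeight_leftInverse hk' hkm hγ'1 hn (hb.pos n hn) _).1
    · filter_upwards [eventually_ge_atTop 1, hω] with n hn hn'
      rw [← hcdf n hn]
      exact (integrableOn_endpointWeight_leftInverse hk' hkm hγ'1 hn (hb.pos n hn) _).2.trans_le hn'
  · have hweight := ae_tendsto_sum_comp_div hξ_meas hξ_indep hξ_unif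
      (measurable_endpointWeight γ') (integrableOn_endpointWeight hγ'1)
    filter_upwards [hweight, hfill, hemp, ae_forall_mem_Ioo hξ_meas hξ_unif]
      with ω hω hωfill hωemp hmem
    have hmain := tendsto_integral_indicator_mul_scoreFun
      (q := fun n u => blockOrderStat (fun i : Fin n => ξ i ω) ⌈(n : ℝ) * u⌉₊)
      -- The averages of the weight converge by the strong law, so they are eventually below their
      -- limit plus `1`.
      (C := 8) (γ' := γ') (C' := (∫ t in Set.Ioo (0 : ℝ) 1, endpointWeight γ' t) + 1)
      hM hb₁ hb₂ hδ hJ hbound hsmooth hadm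
      (fun n => (measurable_blockOrderStat_ceil _).aemeasurable)
      (fun u hu => tendsto_blockOrderStat hωemp hu) (by norm_num) ?_ hγγ' hγ'1 ?_ ?_
    · refine hmain.congr' ?_
      filter_upwards [eventually_ge_atTop 1] with n hn
      exact (lStatistic_eq_integral g c hn hmem).symm
    · filter_upwards [hωfill, eventually_ge_atTop 1] with n hf hn u hu hq
      exact blockOrderStat_bounds hn hadm.eps_pos hadm.eps_lt_one hf hu hq
    · filter_upwards [eventually_ge_atTop 1] with n hn
      exact (integral_indicator_blockOrderStat hn hmem _).1
    · filter_upwards [eventually_ge_atTop 1,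
        hω.eventually (gt_mem_nhds (lt_add_one _))] with n hn hn'
      exact (integral_indicator_blockOrderStat hn hmem _).2.trans_le hn'.le
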